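/- **Theorem (Tightness of the interpolated SGD processes).** Fix $\tau>0$. *Algorithm.* For integers $d,T\ge 1$ let $\theta^*\in\mathbb R^d$, let $\theta^0$ be a random vector in $\mathbb R^d$, and let $\eta>0$, $\sigma\ge 0$ (all of these may depend on $d,T$, as may the underlying probability space). Given samples $x^t\in\mathbb R^d$ and noises $\varepsilon^t\in\mathbb R$, $t\ge 0$, put $y^t=\langle x^t,\theta^*\rangle+\varepsilon^t$ and $\theta^{t+1}=\theta^t+\eta\,(y^t-\langle x^t,\theta^t\rangle)\,x^t$, and let $\Delta\theta^t=\theta^t-\theta^*$, i.e. $$\Delta\theta^{t+1}_i=\Delta\theta^t_i-\eta\sum_{j=1}^d x^t_ix^t_j\,\Delta\theta^t_j+\eta\, x^t_i\varepsilon^t,\qquad 1\le i\le d .$$ Set $\Delta\theta^t_0:=\Delta\theta^t_1$. The interpolated process $\overline\Theta^{d,T}$ is, for $s\in[0,\tau]$ and $x\in[0,1]$, $$\overline\Theta^{d,T}(s,x)=(\lfloor sT\rfloor+1-sT)\,I^{\lfloor sT\rfloor}(x)+(sT-\lfloor sT\rfloor)\,I^{\lfloor sT\rfloor+1}(x),$$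 $$I^t(x)=(\lfloor dx\rfloor+1-dx)\,\Delta\theta^t_{\lfloor dx\rfloor}+(dx-\lfloor dx\rfloor)\,\Delta\theta^t_{\lfloor dx\rfloor+1}$$ (for $x=1$ the second term of $I^t$ has weight $0$ and is omitted). It is a random element of $C([0,\tau];C([0,1]))$ with the uniform topology. *Data.* Let $A,B,E$ be real-valued symmetric functions on $[0,1]^2$, $[0,1]^4$, $[0,1]^8$, not depending on $d,T$. For all $d,T$, $x^t_i=W(t/T,i/d)$, where $\{W(s,x)\}_{s\ge 0,\,x\in[0,1]}$ is a process whose slices $W(s,\cdot)$, $s\ge0$, are independent, with $W(s,x)\in L^8$ and, for all $s\ge 0$ and $x_1,\dots,x_8\in[0,1]$, $$\mathbb E[W(s,x_1)]=0,\quad \mathbb E[W(s,x_1)W(s,x_2)]=A(x_1,x_2),\quad \mathbb E\Big[\prod_{i=1}^4W(s,x_i)\Big]=B(x_1,\dots,x_4),\quad \mathbb E\Big[\prod_{i=1}^8W(s,x_i)\Big]=E(x_1,\dots,x_8).$$ *Noise.* The $\varepsilon^t$, $t\ge 0$, are independent, and $\mathbb E[\varepsilon^t]=0$, $\mathbb E|\varepsilon^t|^2\le\sigma^2$,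 $\mathbb E|\varepsilon^t|^4\le C_1\sigma^4$, with $C_1>0$ not depending on $t,d,T$. The process $W$ is independent of $(\theta^0,(\varepsilon^t)_{t\ge 0})$. *Smoothness.* $A(x,\cdot)\in C^1([0,1])$ for every $x$, and there are constants $C_4,\dots,C_9$ such that for all points of $[0,1]$: - $|A(x,x)+A(y,y)-2A(x,y)|\le C_4^2|x-y|^2$; - $|B|\le C_5$ and $|B(x_1,x_3,x_1,x_3)+B(x_2,x_3,x_2,x_3)-2B(x_1,x_3,x_2,x_3)|\le C_6^2|x_1-x_2|^2$; - $|B(x_1,x_1,x_1,x_1)+B(x_2,x_2,x_2,x_2)+6B(x_1,x_1,x_2,x_2)-4B(x_1,x_1,x_1,x_2)-4B(x_1,x_2,x_2,x_2)|\le C_7^4|x_1-x_2|^4$; - $E\le C_8$ and, writing $z=(x_3,\dots,x_6)$, $|E(x_1,x_1,x_1,x_1,z)+E(x_2,x_2,x_2,x_2,z)+6E(x_1,x_1,x_2,x_2,z)-4E(x_1,x_1,x_1,x_2,z)-4E(x_1,x_2,x_2,x_2,z)|\le C_9^4|x_1-x_2|^4$. *Initial conditions.* There are constants $R,L$ not depending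 on $d,T$ such that $\mathbb E|\Delta\theta^0_i|^4\le R^4$ for $0\le i\le d$ and $\mathbb E|\Delta\theta^0_i-\Delta\theta^0_{i-1}|^4\le L^4d^{-4}$ for $1\le i\le d$. *Scaling.* There is a constant $C>0$ such that $\max(\eta dT,\ \eta\sigma T^{1/2})\le C$ for all $d,T\ge1$. *Conclusion.* The family $\{\overline\Theta^{d,T}\}_{d\ge1,\,T\ge 1}$ is tight in $C([0,\tau];C([0,1]))$. Hence every sequence $(\overline\Theta^{d_k,T_k})_{k\ge1}$ of members of the family has a subsequence that converges weakly (in distribution) to a random element of $C([0,\tau];C([0,1]))$. -/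

import Mathlib

open MeasureTheory ProbabilityTheory Filter Topology
open scoped NNReal

noncomputable section

namespace OnlineSGD

/-- The unit interval `[0,1]`. -/
abbrev I : Type := unitInterval

/-! ### Piecewise linear interpolation -/

/-- The piecewise linear interpolation of a sequence `a 0, a 1, a 2, …` placed at the nodes
`0, 1, 2, …`: for `u ≥ 0` its value is
`(⌊u⌋ + 1 - u) a_{⌊u⌋} + (u - ⌊u⌋) a_{⌊u⌋ + 1}`. -/
def linInterp {V : Type*} [AddCommGroup V] [Module ℝ V] (a : ℕ → V) (u : ℝ) : V :=
  ((⌊u⌋₊ : ℝ) + 1 - u) • a ⌊u⌋₊ + (u - (⌊u⌋₊ : ℝ)) • a (⌊u⌋₊ + 1)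

theorem continuous_linInterp {V : Type*} [AddCommGroup V] [Module ℝ V] [TopologicalSpace V]
    [ContinuousAdd V] [ContinuousSMul ℝ V] (a : ℕ → V) : Continuous (linInterp a) := by
  let S : ℕ → Set ℝ := fun n => {u | (n = 0 ∨ (n : ℝ) ≤ u) ∧ u ≤ (n : ℝ) + 1}
  have hclosed : ∀ n, IsClosed (S n) := by
    intro n
    suffices h : IsClosed {u : ℝ | n = 0 ∨ (n : ℝ) ≤ u} from
      h.inter (isClosed_le continuous_id continuous_const)
    by_cases hn : n = 0
    · have h : {u : ℝ | n = 0 ∨ (n : ℝ) ≤ u} = Set.univ := by ext u; simp [hn]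
      exact h.symm ▸ isClosed_univ (X := ℝ)
    · have h : {u : ℝ | n = 0 ∨ (n : ℝ) ≤ u} = Set.Ici (n : ℝ) := by ext u; simp [hn]
      exact h.symm ▸ isClosed_Ici (a := (n : ℝ))
  have hlf : LocallyFinite S := by
    intro u₀
    refine ⟨Set.Iio (u₀ + 1), Iio_mem_nhds (by linarith), ?_⟩
    refine (Set.finite_Iic (⌈u₀ + 1⌉₊)).subset ?_
    rintro n ⟨u, ⟨h1, -⟩, h2⟩
    rcases h1 with h1 | h1
    · simp [h1]
    · have h3 : (n : ℝ) ≤ (⌈u₀ + 1⌉₊ : ℝ) := (h1.trans h2.le).trans (Nat.le_ceil _)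
      exact_mod_cast h3
  refine hlf.continuous ?_ hclosed ?_
  · refine Set.eq_univ_of_forall fun u => Set.mem_iUnion.2 ⟨⌊u⌋₊, ?_, (Nat.lt_floor_add_one u).le⟩
    by_cases hu : 0 ≤ u
    · exact Or.inr (Nat.floor_le hu)
    · exact Or.inl (Nat.floor_of_nonpos (not_le.1 hu).le)
  · intro n
    have hc : Continuous fun u : ℝ => ((n : ℝ) + 1 - u) • a n + (u - (n : ℝ)) • a (n + 1) := by
      fun_prop
    refine hc.continuousOn.congr ?_
    rintro u ⟨h1, h2⟩
    rcases h2.eq_or_lt with h2 | h2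
    · have hf : ⌊u⌋₊ = n + 1 := by
        rw [h2]; exact_mod_cast Nat.floor_natCast (R := ℝ) (n + 1)
      simp only [linInterp, hf]
      rw [h2]
      push_cast
      simp
    · have hf : ⌊u⌋₊ = n := by
        rcases h1 with h1 | h1
        · subst h1
          exact Nat.floor_eq_zero.2 (by simpa using h2)
        · exact (Nat.floor_eq_iff ((Nat.cast_nonneg n).trans h1)).2 ⟨h1, h2⟩
      simp only [linInterp, hf]

/-! ### Online least-squares SGD -/

/-- One trajectory of online least-squares SGD in dimension `d` with step size `η`, samples `x t`,
responses `y t` and initial guess `θ₀`:  `θ^{t+1} = θ^t + η (y^t - ⟨x^t, θ^t⟩) x^t`. -/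
def sgd {d : ℕ} (η : ℝ) (x : ℕ → Fin d → ℝ) (y : ℕ → ℝ) (θ₀ : Fin d → ℝ) : ℕ → Fin d → ℝ
  | 0 => θ₀
  | t + 1 => sgd η x y θ₀ t + (η * (y t - x t ⬝ᵥ sgd η x y θ₀ t)) • x t

/-- The `i`-th coordinate, `1 ≤ i ≤ d`, of a vector of `ℝ^d` (in Lean, the coordinate of index
`i - 1` of `Fin d`), with the convention that the coordinate of index `0` is the first one.
Indices `i > d` only ever occur with weight `0`. -/
def coord {d : ℕ} (v : Fin d → ℝ) (i : ℕ) : ℝ :=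
  if h : i - 1 < d then v ⟨i - 1, h⟩ else 0

/-- The spatial grid point `(k + 1) / d`, `k = 0, …, d - 1`. -/
def gridPoint {d : ℕ} (k : Fin d) : I :=
  ⟨((k : ℝ) + 1) / d, by
    have hd : (0 : ℝ) < d := by exact_mod_cast k.pos
    have hk : (k : ℝ) + 1 ≤ d := by exact_mod_cast k.isLt
    exact ⟨by positivity, (div_le_one hd).2 hk⟩⟩

/-- The samples `x^t_i = W(t/T, i/d)`. -/
def sample {Ω : Type*} (d T : ℕ) (W : ℝ≥0 → I → Ω → ℝ) (ω : Ω) (t : ℕ) : Fin d → ℝ :=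
  fun k => W ((t : ℝ≥0) / T) (gridPoint k) ω

/-- The centred iterates `Δθ^t = θ^t - θ^*` of online SGD for the linear model
`y^t = ⟨x^t, θ^*⟩ + ε^t` with samples `x^t_i = W(t/T, i/d)`. -/
def centeredIterate {Ω : Type*} (d T : ℕ) (η : ℝ) (W : ℝ≥0 → I → Ω → ℝ) (ε : ℕ → Ω → ℝ)
    (θstar : Fin d → ℝ) (θ₀ : Ω → Fin d → ℝ) (ω : Ω) (t : ℕ) : Fin d → ℝ :=
  sgd η (sample d T W ω) (fun t => sample d T W ω t ⬝ᵥ θstar + ε t ω) (θ₀ ω) t - θstar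

/-! ### The interpolated process -/

/-- The path space `C([0,τ]; C([0,1]))`, with the topology of uniform convergence. -/
abbrev PathSpace (τ : ℝ) : Type := C(Set.Icc (0 : ℝ) τ, C(I, ℝ))

instance (τ : ℝ) : MeasurableSpace (PathSpace τ) := borel _

instance (τ : ℝ) : BorelSpace (PathSpace τ) := ⟨rfl⟩

/-- Piecewise linear interpolation in space, with the `i`-th coordinate placed at `i / d`:
`x ↦ (⌊dx⌋ + 1 - dx) v_{⌊dx⌋} + (dx - ⌊dx⌋) v_{⌊dx⌋ + 1}`. -/
def spaceInterp {d : ℕ} (v : Fin d → ℝ) : C(I, ℝ) where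
  toFun x := linInterp (coord v) ((d : ℝ) * x)
  continuous_toFun := (continuous_linInterp _).comp (by fun_prop)

/-- The space-time interpolation on `[0,τ] × [0,1]` of the vectors `v 0, v 1, …`, which is
piecewise linear in time (grid width `1 / T`) and in space (grid width `1 / d`). -/
def spaceTimeInterp {d : ℕ} (τ : ℝ) (T : ℕ) (v : ℕ → Fin d → ℝ) : PathSpace τ where
  toFun s := linInterp (fun t => spaceInterp (v t)) ((T : ℝ) * s)
  continuous_toFun := (continuous_linInterp _).comp (by fun_prop)

/-- The interpolated SGD process, as a random element of `C([0,τ]; C([0,1]))`. -/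
def interpolatedSGD {Ω : Type*} (τ : ℝ) (d T : ℕ) (η : ℝ) (W : ℝ≥0 → I → Ω → ℝ)
    (ε : ℕ → Ω → ℝ) (θstar : Fin d → ℝ) (θ₀ : Ω → Fin d → ℝ) (ω : Ω) : PathSpace τ :=
  spaceTimeInterp τ T (centeredIterate d T η W ε θstar θ₀ ω)

/-! ### Assumptions -/

/-- `W` is a centred space-time process, white in time (the slices `W(s, ·)`, `s ≥ 0`, are
independent), whose second, fourth and eighth spatial moments at every time are the symmetric
functions `A`, `B` and `E`. The moments are genuine ones: `W(s,x) ∈ L⁸`. -/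
structure IsDataProcess {Ω : Type*} [MeasurableSpace Ω] (P : Measure Ω) (W : ℝ≥0 → I → Ω → ℝ)
    (A : I → I → ℝ) (B : (Fin 4 → I) → ℝ) (E : (Fin 8 → I) → ℝ) : Prop where
  symm_A : ∀ x y, A x y = A y x
  symm_B : ∀ (p : Equiv.Perm (Fin 4)) (x : Fin 4 → I), B (x ∘ p) = B x
  symm_E : ∀ (p : Equiv.Perm (Fin 8)) (x : Fin 8 → I), E (x ∘ p) = E x
  measurable : ∀ s x, Measurable (W s x)
  memLp : ∀ s x, MemLp (W s x) 8 P
  white : iIndepFun (fun (s : ℝ≥0) (ω : Ω) (x : I) => W s x ω) P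
  mean : ∀ s x, ∫ ω, W s x ω ∂P = 0
  moment_two : ∀ s x₁ x₂, ∫ ω, W s x₁ ω * W s x₂ ω ∂P = A x₁ x₂
  moment_four : ∀ s (x : Fin 4 → I), ∫ ω, ∏ i, W s (x i) ω ∂P = B x
  moment_eight : ∀ s (x : Fin 8 → I), ∫ ω, ∏ i, W s (x i) ω ∂P = E x

/-- The noise variables are independent and centred, with variance at most `σ²` and fourth moment
at most `C₁ σ⁴`. -/
structure IsNoise {Ω : Type*} [MeasurableSpace Ω] (P : Measure Ω) (ε : ℕ → Ω → ℝ)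
    (σ C₁ : ℝ) : Prop where
  measurable : ∀ t, Measurable (ε t)
  memLp : ∀ t, MemLp (ε t) 4 P
  indep : iIndepFun ε P
  mean : ∀ t, ∫ ω, ε t ω ∂P = 0
  moment_two : ∀ t, ∫ ω, |ε t ω| ^ 2 ∂P ≤ σ ^ 2
  moment_four : ∀ t, ∫ ω, |ε t ω| ^ 4 ∂P ≤ C₁ * σ ^ 4

/-- The smoothness conditions on the moment functions `A`, `B`, `E`. The bounds `|A| ≤ C₂` and
`|A(x,z) - A(y,z)| ≤ C₃ |x - y|` are not listed: they follow by Cauchy-Schwarz from `increment_A`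
when `A` is a covariance function. -/
structure SmoothMoments (A : I → I → ℝ) (B : (Fin 4 → I) → ℝ) (E : (Fin 8 → I) → ℝ) : Prop where
  contDiff_A : ∀ x, ContDiffOn ℝ 1 (Set.IccExtend zero_le_one (A x)) (Set.Icc 0 1)
  increment_A : ∃ C₄ : ℝ, ∀ x y : I,
    |A x x + A y y - 2 * A x y| ≤ C₄ ^ 2 * |(x : ℝ) - y| ^ 2
  bound_B : ∃ C₅ : ℝ, ∀ x, |B x| ≤ C₅
  increment_two_B : ∃ C₆ : ℝ, ∀ x₁ x₂ x₃ : I,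
    |B ![x₁, x₃, x₁, x₃] + B ![x₂, x₃, x₂, x₃] - 2 * B ![x₁, x₃, x₂, x₃]|
      ≤ C₆ ^ 2 * |(x₁ : ℝ) - x₂| ^ 2
  increment_four_B : ∃ C₇ : ℝ, ∀ x₁ x₂ : I,
    |B ![x₁, x₁, x₁, x₁] + B ![x₂, x₂, x₂, x₂] + 6 * B ![x₁, x₁, x₂, x₂]
        - 4 * B ![x₁, x₁, x₁, x₂] - 4 * B ![x₁, x₂, x₂, x₂]|
      ≤ C₇ ^ 4 * |(x₁ : ℝ) - x₂| ^ 4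
  bound_E : ∃ C₈ : ℝ, ∀ x, E x ≤ C₈
  increment_four_E : ∃ C₉ : ℝ, ∀ x₁ x₂ x₃ x₄ x₅ x₆ : I,
    |E ![x₁, x₁, x₁, x₁, x₃, x₄, x₅, x₆] + E ![x₂, x₂, x₂, x₂, x₃, x₄, x₅, x₆]
        + 6 * E ![x₁, x₁, x₂, x₂, x₃, x₄, x₅, x₆]
        - 4 * E ![x₁, x₁, x₁, x₂, x₃, x₄, x₅, x₆]
        - 4 * E ![x₁, x₂, x₂, x₂, x₃, x₄, x₅, x₆]|
      ≤ C₉ ^ 4 * |(x₁ : ℝ) - x₂| ^ 4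

/-- The initial conditions: with `v = Δθ⁰`, `𝔼|v_i|⁴ ≤ R⁴` for `0 ≤ i ≤ d` and
`𝔼|v_i - v_{i-1}|⁴ ≤ L⁴ d⁻⁴` for `1 ≤ i ≤ d`. -/
structure IsInitialCondition {Ω : Type*} [MeasurableSpace Ω] (P : Measure Ω) {d : ℕ}
    (v : Ω → Fin d → ℝ) (R L : ℝ) : Prop where
  measurable : Measurable v
  memLp : ∀ k, MemLp (fun ω => v ω k) 4 P
  moment : ∀ i ≤ d, ∫ ω, |coord (v ω) i| ^ 4 ∂P ≤ R ^ 4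
  increment : ∀ i, 1 ≤ i → i ≤ d →
    ∫ ω, |coord (v ω) i - coord (v ω) (i - 1)| ^ 4 ∂P ≤ L ^ 4 * (d : ℝ)⁻¹ ^ 4

end OnlineSGD

end

namespace OnlineSGD

/-! ### Compactness in spaces of continuous functions, and weak subsequential limits -/

/-! Everything is controlled by the discrete `W^{1,4}` energy of the centred iterates: one
coordinate plus an average over `d` rescaled differences `d (Δ_{k+1} - Δ_k)`. Call these linear
functionals features. In space, Hölder's inequality turns an energy bound into a sup bound and a
`3/4`-Hölder bound, uniformly in `d` (`abs_coord_sub_le`).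

In time, one feature `ℓ` is treated at a time. A step adds `ℓ(ξ^t) (η ε^t - η ⟨ξ^t, Δ^t⟩)`, where
the sample `ξ^t` is independent of the past and of `ε^t`. In the conditional fourth moment the noise
has no first-order effect, because `ℓ(ξ^t)` is centred, and the first-order effect of the drift is
proportional to the `ℓ¹` norm of `η Δ^t` (`lintegral_step_le`, `integral_step_le`). The scaling
makes the drift of order `1/T` and the noise of order `T^{-1/2}`, as in an Euler scheme for a
stochastic differential equation. The fourth-difference conditions on `B` and `E` say that
difference quotients of `W` have moments as bounded as those of `W` (`exists_momentBound`), so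
coordinates and differences obey the same estimate. A Grönwall argument bounds the fourth moments of
the coordinates. A second induction gives `𝔼 |ℓ(Δ^t) - ℓ(Δ^s)|⁴ ≤ c ((t - s)/T)²`, with `c`
independent of `d`, `T` and the feature (`exists_moment_estimates`).

Kolmogorov's chaining is then done with a statistic that is additive in fourth powers: a weighted
sum of the fourth powers of all dyadic time increments has bounded expectation and dominates every
`(f j - f i)⁴`, up to the factor `((j - i)/T)^{1/2}` (`integral_chainSum_le`,
`pow_four_sub_le_chainSum`). Averaging it over the features costs nothing in `d`. The resulting
`pathStat` controls the energy of the initial vector and of all time increments, so a path with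
bounded `pathStat` is `1/8`-Hölder in time with values in a compact Hölder ball
(`spaceTimeInterp_mem_of_pathStat_le`). Such paths form a compact set by Arzelà-Ascoli. Markov's
inequality gives tightness and Prokhorov's theorem the limits. -/

theorem continuous_of_dist_le_rpow {X Y : Type*} [PseudoMetricSpace X] [PseudoMetricSpace Y]
    {f : X → Y} {H γ : ℝ} (hγ : 0 < γ) (h : ∀ x y, dist (f x) (f y) ≤ H * dist x y ^ γ) :
    Continuous f := by
  rw [continuous_iff_continuousAt]
  intro x
  rw [ContinuousAt, tendsto_iff_dist_tendsto_zero]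
  have h1 : Tendsto (fun y => H * dist y x ^ γ) (𝓝 x) (𝓝 (H * (0 : ℝ) ^ γ)) := by
    refine (Tendsto.rpow_const ?_ (Or.inr hγ.le)).const_mul H
    exact tendsto_iff_dist_tendsto_zero.1 tendsto_id
  rw [Real.zero_rpow hγ.ne', mul_zero] at h1
  exact squeeze_zero (fun _ => dist_nonneg) (fun y => h y x) h1

/-- Arzelà-Ascoli with a common modulus of continuity. For pointwise convergence the set is closed
in the Tychonoff-compact product of copies of `K`, since the Hölder bound alone makes a function
continuous. The target `Y` is general because it will be both `ℝ` and `C(I, ℝ)`. -/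
theorem isCompact_setOf_dist_le_rpow {X Y : Type*} [PseudoMetricSpace X] [MetricSpace Y]
    {K : Set Y} (hK : IsCompact K) (H : ℝ) {γ : ℝ} (hγ : 0 < γ) :
    IsCompact {f : C(X, Y) | (∀ x, f x ∈ K) ∧ ∀ x y, dist (f x) (f y) ≤ H * dist x y ^ γ} := by
  refine ArzelaAscoli.isCompact_of_equicontinuous _ ?_ ?_
  · have himg : ContinuousMap.toFun ''
        {f : C(X, Y) | (∀ x, f x ∈ K) ∧ ∀ x y, dist (f x) (f y) ≤ H * dist x y ^ γ}
        = (Set.univ.pi fun _ => K) ∩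
          ⋂ x, ⋂ y, {g : X → Y | dist (g x) (g y) ≤ H * dist x y ^ γ} := by
      ext g
      simp only [Set.mem_image, Set.mem_ofPred_eq, Set.mem_inter_iff, Set.mem_pi, Set.mem_univ,
        true_implies, Set.mem_iInter]
      constructor
      · rintro ⟨f, hf, rfl⟩
        exact hf
      · intro hg
        exact ⟨⟨g, continuous_of_dist_le_rpow hγ hg.2⟩, hg, rfl⟩
    rw [himg]
    refine (isCompact_univ_pi fun _ => hK).inter_right ?_
    refine isClosed_iInter fun x => isClosed_iInter fun y => isClosed_le ?_ continuous_const
    exact (continuous_apply x).dist (continuous_apply y)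
  · intro x
    rw [Metric.equicontinuousAt_iff_right]
    intro e he
    have h1 : Tendsto (fun y => H * dist x y ^ γ) (𝓝 x) (𝓝 (H * (0 : ℝ) ^ γ)) := by
      refine (Tendsto.rpow_const ?_ (Or.inr hγ.le)).const_mul H
      have := tendsto_iff_dist_tendsto_zero.1 (tendsto_id (x := 𝓝 x))
      simpa [dist_comm] using this
    rw [Real.zero_rpow hγ.ne', mul_zero] at h1
    filter_upwards [h1.eventually (gt_mem_nhds he)] with y hy f
    exact (f.2.2 x y).trans_lt hy

/-- Prokhorov's theorem makes the closure of the set of laws compact. The variables may live on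
different probability spaces, as only their laws matter. -/
theorem exists_subseq_tendstoInDistribution {E : Type*} [TopologicalSpace E]
    [TopologicalSpace.MetrizableSpace E] [TopologicalSpace.SeparableSpace E]
    [MeasurableSpace E] [BorelSpace E] {Ω : ℕ → Type*} [∀ k, MeasurableSpace (Ω k)]
    (P : ∀ k, Measure (Ω k)) [∀ k, IsProbabilityMeasure (P k)] (X : ∀ k, Ω k → E)
    (hX : ∀ k, Measurable (X k))
    (h : IsTightMeasureSet (Set.range fun k => (P k).map (X k))) :
    ∃ φ : ℕ → ℕ, StrictMono φ ∧ ∃ (μ : Measure E) (_ : IsProbabilityMeasure μ),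
      TendstoInDistribution (fun k => X (φ k)) atTop id (fun k => P (φ k)) μ := by
  let ν : ℕ → ProbabilityMeasure E := fun k =>
    ⟨(P k).map (X k), Measure.isProbabilityMeasure_map (hX k).aemeasurable⟩
  have hcomp : IsCompact (closure (Set.range ν)) := by
    refine isCompact_closure_of_isTightMeasureSet (h.subset ?_)
    rintro _ ⟨_, ⟨k, rfl⟩, rfl⟩
    exact ⟨k, rfl⟩
  obtain ⟨μ, -, φ, hφ, hlim⟩ :=
    hcomp.tendsto_subseq fun k => subset_closure (Set.mem_range_self (f := ν) k)
  refine ⟨φ, hφ, μ, inferInstance, fun k => (hX _).aemeasurable, aemeasurable_id, ?_⟩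
  have hid : (⟨(μ : Measure E).map id, Measure.isProbabilityMeasure_map aemeasurable_id⟩ :
      ProbabilityMeasure E) = μ := Subtype.ext Measure.map_id
  rw [hid]
  exact hlim

/-! ### Piecewise linear interpolation: convexity and Hölder bounds -/

section LinInterp

variable {V : Type*} [AddCommGroup V] [Module ℝ V]

/-- At the right end `u = n + 1` the floor jumps, but both formulas give `a (n + 1)`. Closed cells
spare later case distinctions. -/
theorem linInterp_of_mem_cell (a : ℕ → V) {u : ℝ} {n : ℕ} (h1 : (n : ℝ) ≤ u)
    (h2 : u ≤ (n : ℝ) + 1) :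
    linInterp a u = ((n : ℝ) + 1 - u) • a n + (u - (n : ℝ)) • a (n + 1) := by
  rcases h2.eq_or_lt with h2 | h2
  · have hf : ⌊u⌋₊ = n + 1 := by
      rw [h2]; exact_mod_cast Nat.floor_natCast (R := ℝ) (n + 1)
    simp only [linInterp, hf]
    rw [h2]
    push_cast
    simp
  · have hf : ⌊u⌋₊ = n := (Nat.floor_eq_iff ((Nat.cast_nonneg n).trans h1)).2 ⟨h1, h2⟩
    simp only [linInterp, hf]

theorem exists_cell {u : ℝ} {N : ℕ} (hN : 0 < N) (h0 : 0 ≤ u) (h1 : u ≤ N) :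
    ∃ n < N, (n : ℝ) ≤ u ∧ u ≤ (n : ℝ) + 1 := by
  rcases h1.eq_or_lt with h | h
  · refine ⟨N - 1, by omega, ?_⟩
    have : ((N - 1 : ℕ) : ℝ) = N - 1 := by rw [Nat.cast_sub hN]; simp
    rw [this, h]
    constructor <;> linarith
  · exact ⟨⌊u⌋₊, (Nat.floor_lt h0).2 h, Nat.floor_le h0, (Nat.lt_floor_add_one u).le⟩

theorem linInterp_mem_of_convex {S : Set V} (hS : Convex ℝ S) {a : ℕ → V} {N : ℕ} (hN : 0 < N)
    (ha : ∀ i ≤ N, a i ∈ S) {u : ℝ} (h0 : 0 ≤ u) (h1 : u ≤ N) : linInterp a u ∈ S := by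
  obtain ⟨n, hn, h2, h3⟩ := exists_cell hN h0 h1
  rw [linInterp_of_mem_cell a h2 h3]
  exact hS (ha n hn.le) (ha (n + 1) hn) (by linarith) (by linarith) (by ring)

end LinInterp

section Holder

variable {V : Type*} [NormedAddCommGroup V] [NormedSpace ℝ V]

/-- Two points in different cells are joined through the end of the first cell and the start of the
last one. Each of the three pieces costs at most `H * (u' - u) ^ γ`, hence the factor `3`. Inside
one cell the interpolant is affine, and `r ≤ r ^ γ` on `[0,1]`. -/
theorem norm_linInterp_sub_le {a : ℕ → V} {N : ℕ} {H γ : ℝ} (hH : 0 ≤ H) (hγ : 0 ≤ γ)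
    (hγ1 : γ ≤ 1) (ha : ∀ i j, i ≤ j → j ≤ N → ‖a j - a i‖ ≤ H * ((j : ℝ) - i) ^ γ)
    (hN : 0 < N) {u u' : ℝ} (h0 : 0 ≤ u) (huu : u ≤ u') (h1 : u' ≤ N) :
    ‖linInterp a u' - linInterp a u‖ ≤ 3 * H * (u' - u) ^ γ := by
  have hstep : ∀ n < N, ‖a (n + 1) - a n‖ ≤ H := by
    intro n hn
    have := ha n (n + 1) (by omega) hn
    simpa using this
  have hself : ∀ r : ℝ, 0 ≤ r → r ≤ 1 → r ≤ r ^ γ := by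
    intro r hr hr1
    rcases hr.eq_or_lt with h | h
    · rw [← h]; exact Real.zero_rpow_nonneg γ
    · simpa using Real.rpow_le_rpow_of_exponent_ge h hr1 hγ1
  obtain ⟨n, hn, h2, h3⟩ := exists_cell hN h0 (huu.trans h1)
  obtain ⟨m, hm, h4, h5⟩ := exists_cell hN (h0.trans huu) h1
  have hcell : ∀ w : ℝ, ∀ k < N, (k : ℝ) ≤ w → w ≤ (k : ℝ) + 1 →
      ‖linInterp a w - a k‖ ≤ H * (w - k) ^ γ ∧ ‖a (k + 1) - linInterp a w‖ ≤ H * (k + 1 - w) ^ γ := by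
    intro w k hk hw1 hw2
    rw [linInterp_of_mem_cell a hw1 hw2]
    have e1 : ((k : ℝ) + 1 - w) • a k + (w - (k : ℝ)) • a (k + 1) - a k
        = (w - (k : ℝ)) • (a (k + 1) - a k) := by module
    have e2 : a (k + 1) - (((k : ℝ) + 1 - w) • a k + (w - (k : ℝ)) • a (k + 1))
        = ((k : ℝ) + 1 - w) • (a (k + 1) - a k) := by module
    rw [e1, e2, norm_smul, norm_smul, Real.norm_of_nonneg (by linarith),
      Real.norm_of_nonneg (by linarith), mul_comm, mul_comm _ ‖_‖]
    exact ⟨mul_le_mul (hstep k hk) (hself _ (by linarith) (by linarith)) (by linarith) hH,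
      mul_le_mul (hstep k hk) (hself _ (by linarith) (by linarith)) (by linarith) hH⟩
  by_cases hnm : n + 1 ≤ m
  · have hnm' : (n : ℝ) + 1 ≤ m := by exact_mod_cast hnm
    have e : linInterp a u' - linInterp a u = (linInterp a u' - a m) + (a m - a (n + 1))
        + (a (n + 1) - linInterp a u) := by abel
    have b1 := (hcell u' m hm h4 h5).1
    have b2 := ha (n + 1) m hnm hm.le
    have b3 := (hcell u n hn h2 h3).2
    have c1 : (u' - m) ^ γ ≤ (u' - u) ^ γ :=
      Real.rpow_le_rpow (by linarith) (by linarith) hγ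
    have c2 : ((m : ℝ) - (n + 1 : ℕ)) ^ γ ≤ (u' - u) ^ γ :=
      Real.rpow_le_rpow (by push_cast; linarith) (by push_cast; linarith) hγ
    have c3 : ((n : ℝ) + 1 - u) ^ γ ≤ (u' - u) ^ γ :=
      Real.rpow_le_rpow (by linarith) (by linarith) hγ
    calc ‖linInterp a u' - linInterp a u‖
        ≤ ‖linInterp a u' - a m‖ + ‖a m - a (n + 1)‖ + ‖a (n + 1) - linInterp a u‖ := by
          rw [e]; exact norm_add₃_le
      _ ≤ H * (u' - u) ^ γ + H * (u' - u) ^ γ + H * (u' - u) ^ γ := by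
          gcongr
          · exact b1.trans (by gcongr)
          · exact b2.trans (by gcongr)
          · exact b3.trans (by gcongr)
      _ = 3 * H * (u' - u) ^ γ := by ring
  · have hmn : m ≤ n := by omega
    have hu'n : u' ≤ (n : ℝ) + 1 := h5.trans (by gcongr)
    rw [linInterp_of_mem_cell a h2 h3, linInterp_of_mem_cell a (h2.trans huu) hu'n]
    have e1 : ((n : ℝ) + 1 - u') • a n + (u' - (n : ℝ)) • a (n + 1)
        - (((n : ℝ) + 1 - u) • a n + (u - (n : ℝ)) • a (n + 1))
        = (u' - u) • (a (n + 1) - a n) := by module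
    rw [e1, norm_smul, Real.norm_of_nonneg (by linarith)]
    have h6 := hself (u' - u) (by linarith) (by linarith)
    have h7 := hstep n hn
    have h8 : 0 ≤ H * (u' - u) ^ γ := mul_nonneg hH (Real.rpow_nonneg (by linarith) _)
    calc (u' - u) * ‖a (n + 1) - a n‖ ≤ (u' - u) ^ γ * H :=
          mul_le_mul h6 h7 (norm_nonneg _) (Real.rpow_nonneg (by linarith) _)
      _ ≤ 3 * H * (u' - u) ^ γ := by linarith

end Holder

/-! ### The discrete Sobolev energy of a vector -/

theorem coord_sub {d : ℕ} (v w : Fin d → ℝ) (i : ℕ) :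
    coord (v - w) i = coord v i - coord w i := by
  unfold coord
  split_ifs <;> simp

/-- The discrete `W^{1,4}` energy of a vector: the fourth power of its first coordinate plus the
average of the fourth powers of its difference quotients. -/
noncomputable def energy {d : ℕ} (v : Fin d → ℝ) : ℝ :=
  |coord v 0| ^ 4 + (d : ℝ)⁻¹ * ∑ k ∈ Finset.range d, |d * (coord v (k + 1) - coord v k)| ^ 4

theorem add_pow_four_le (x y : ℝ) : |x + y| ^ 4 ≤ 8 * (|x| ^ 4 + |y| ^ 4) := by
  have h : ∀ z : ℝ, |z| ^ 4 = z ^ 4 := fun z => Even.pow_abs (by decide) z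
  rw [h, h, h]
  nlinarith [sq_nonneg (x ^ 2 - y ^ 2), mul_nonneg (sq_nonneg (x - y)) (sq_nonneg (x + y)),
    mul_nonneg (sq_nonneg (x - y)) (sq_nonneg (x - y)),
    mul_nonneg (sq_nonneg (x - y)) (sq_nonneg x), mul_nonneg (sq_nonneg (x - y)) (sq_nonneg y)]

theorem energy_le_of_sub {d : ℕ} (v w : Fin d → ℝ) :
    energy v ≤ 8 * (energy (v - w) + energy w) := by
  unfold energy
  have h : ∀ i, coord v i = coord (v - w) i + coord w i := fun i => by rw [coord_sub]; ring
  have h1 : |coord v 0| ^ 4 ≤ 8 * (|coord (v - w) 0| ^ 4 + |coord w 0| ^ 4) := by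
    rw [h]; exact add_pow_four_le _ _
  have h2 : ∑ k ∈ Finset.range d, |d * (coord v (k + 1) - coord v k)| ^ 4
      ≤ 8 * (∑ k ∈ Finset.range d, |d * (coord (v - w) (k + 1) - coord (v - w) k)| ^ 4
        + ∑ k ∈ Finset.range d, |d * (coord w (k + 1) - coord w k)| ^ 4) := by
    rw [← Finset.sum_add_distrib, Finset.mul_sum]
    refine Finset.sum_le_sum fun k _ => ?_
    have e : d * (coord v (k + 1) - coord v k) = d * (coord (v - w) (k + 1) - coord (v - w) k)
        + d * (coord w (k + 1) - coord w k) := by rw [h, h]; ring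
    rw [e]; exact add_pow_four_le _ _
  have h3 := mul_le_mul_of_nonneg_left h2 (inv_nonneg.2 (Nat.cast_nonneg (α := ℝ) d))
  linarith

theorem le_of_pow_four_le {x y : ℝ} (hy : 0 ≤ y) (h : x ^ 4 ≤ y ^ 4) : x ≤ y := by
  by_contra hxy
  push Not at hxy
  exact absurd h (not_le.2 (pow_lt_pow_left₀ hxy hy (by norm_num)))

theorem rpow_pow_four {x : ℝ} (hx : 0 ≤ x) (γ : ℝ) : (x ^ γ) ^ 4 = x ^ (4 * γ) := by
  rw [← Real.rpow_natCast, ← Real.rpow_mul hx]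
  congr 1
  push_cast
  ring

/-- A discrete Morrey inequality: Hölder's inequality with exponents `4` and `4/3` on the
telescoping sum, where the fourth powers of the differences sum to at most `d⁻³` times the energy.
-/
theorem abs_coord_sub_le {d : ℕ} (v : Fin d → ℝ) {G : ℝ} (hG : 0 ≤ G) (hv : energy v ≤ G ^ 4)
    {i j : ℕ} (hij : i ≤ j) (hj : j ≤ d) :
    |coord v j - coord v i| ≤ G * (((j : ℝ) - i) / d) ^ (3 / 4 : ℝ) := by
  rcases Nat.eq_zero_or_pos d with hd | hd
  · subst hd
    obtain rfl : j = 0 := by omega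
    obtain rfl : i = 0 := by omega
    simp only [sub_self, abs_zero]
    positivity
  have hd' : (0 : ℝ) < d := by exact_mod_cast hd
  have hij' : (0 : ℝ) ≤ (j : ℝ) - i := sub_nonneg.2 (by exact_mod_cast hij)
  refine le_of_pow_four_le (by positivity) ?_
  rw [mul_pow, rpow_pow_four (by positivity)]
  norm_num only
  rw [show ((3 : ℝ)) = ((3 : ℕ) : ℝ) by norm_num, Real.rpow_natCast]
  have h1 : |coord v j - coord v i| ≤ ∑ k ∈ Finset.Ico i j, |coord v (k + 1) - coord v k| := by
    rw [← Finset.sum_Ico_sub _ hij]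
    exact Finset.abs_sum_le_sum_abs _ _
  have h2 : (∑ k ∈ Finset.Ico i j, |coord v (k + 1) - coord v k|) ^ 4
      ≤ ((j : ℝ) - i) ^ 3 * ∑ k ∈ Finset.Ico i j, |coord v (k + 1) - coord v k| ^ 4 := by
    have hcard : ((Finset.Ico i j).card : ℝ) = (j : ℝ) - i := by
      rw [Nat.card_Ico, Nat.cast_sub hij]
    have h := pow_sum_le_card_mul_sum_pow (s := Finset.Ico i j)
      (f := fun k => |coord v (k + 1) - coord v k|) (fun _ _ => abs_nonneg _) 3
    rwa [hcard] at h
  have h3 : ∑ k ∈ Finset.Ico i j, |coord v (k + 1) - coord v k| ^ 4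
      ≤ ∑ k ∈ Finset.range d, |coord v (k + 1) - coord v k| ^ 4 := by
    refine Finset.sum_le_sum_of_subset_of_nonneg ?_ fun _ _ _ => by positivity
    intro k hk
    rw [Finset.mem_Ico] at hk
    exact Finset.mem_range.2 (by omega)
  have h4 : (d : ℝ) ^ 3 * ∑ k ∈ Finset.range d, |coord v (k + 1) - coord v k| ^ 4 ≤ G ^ 4 := by
    refine le_trans (le_of_eq ?_) ((le_add_of_nonneg_left (by positivity)).trans hv)
    simp only [abs_mul, mul_pow, Nat.abs_cast, ← Finset.mul_sum]
    field_simp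
  calc |coord v j - coord v i| ^ 4
      ≤ (∑ k ∈ Finset.Ico i j, |coord v (k + 1) - coord v k|) ^ 4 := by gcongr
    _ ≤ ((j : ℝ) - i) ^ 3 * ∑ k ∈ Finset.range d, |coord v (k + 1) - coord v k| ^ 4 := by
        refine h2.trans ?_
        gcongr
    _ = ((d : ℝ) ^ 3 * ∑ k ∈ Finset.range d, |coord v (k + 1) - coord v k| ^ 4)
          * (((j : ℝ) - i) / d) ^ 3 := by
        field_simp
    _ ≤ G ^ 4 * (((j : ℝ) - i) / d) ^ 3 := by gcongr

theorem abs_coord_le {d : ℕ} (v : Fin d → ℝ) {G : ℝ} (hG : 0 ≤ G) (hv : energy v ≤ G ^ 4)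
    {j : ℕ} (hj : j ≤ d) : |coord v j| ≤ 2 * G := by
  have h1 := abs_coord_sub_le v hG hv (Nat.zero_le j) hj
  have h2 : |coord v 0| ≤ G := by
    refine le_of_pow_four_le hG (le_trans (le_add_of_nonneg_right ?_) hv)
    positivity
  have h3 : (((j : ℝ) - (0 : ℕ)) / d) ^ (3 / 4 : ℝ) ≤ 1 := by
    refine Real.rpow_le_one ?_ ?_ (by norm_num)
    · simp only [Nat.cast_zero, sub_zero]; positivity
    · simp only [Nat.cast_zero, sub_zero]
      exact div_le_one_of_le₀ (by exact_mod_cast hj) (Nat.cast_nonneg d)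
  have h4 : |coord v j| ≤ |coord v j - coord v 0| + |coord v 0| := by
    simpa using abs_add_le (coord v j - coord v 0) (coord v 0)
  nlinarith

/-! ### From the energy of a vector to Hölder bounds for its interpolation -/

theorem spaceInterp_sub {d : ℕ} (v w : Fin d → ℝ) :
    spaceInterp (v - w) = spaceInterp v - spaceInterp w := by
  ext x
  simp only [spaceInterp, linInterp, ContinuousMap.coe_mk, ContinuousMap.sub_apply, coord_sub,
    smul_eq_mul]
  ring

theorem abs_spaceInterp_le {d : ℕ} (hd : 0 < d) (v : Fin d → ℝ) {G : ℝ} (hG : 0 ≤ G)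
    (hv : energy v ≤ G ^ 4) (x : I) : |spaceInterp v x| ≤ 2 * G := by
  rw [abs_le]
  refine linInterp_mem_of_convex (convex_Icc (-(2 * G)) (2 * G)) hd
    (fun i hi => abs_le.1 (abs_coord_le v hG hv hi)) ?_ ?_
  · have := x.2.1
    positivity
  · exact mul_le_of_le_one_right (Nat.cast_nonneg d) x.2.2

theorem dist_spaceInterp_le {d : ℕ} (hd : 0 < d) (v : Fin d → ℝ) {G : ℝ} (hG : 0 ≤ G)
    (hv : energy v ≤ G ^ 4) (x y : I) :
    dist (spaceInterp v x) (spaceInterp v y) ≤ 3 * G * dist x y ^ (3 / 4 : ℝ) := by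
  wlog hxy : y ≤ x generalizing x y
  · rw [dist_comm, dist_comm x]
    exact this y x (le_of_not_ge hxy)
  have hd' : (0 : ℝ) < d := by exact_mod_cast hd
  have hxy' : (y : ℝ) ≤ x := hxy
  have h := norm_linInterp_sub_le (a := coord v) (N := d) (H := G * (d : ℝ)⁻¹ ^ (3 / 4 : ℝ))
    (γ := 3 / 4) (by positivity) (by norm_num) (by norm_num) (fun i j hij hj => ?_) hd
    (u := d * y) (u' := d * x) (mul_nonneg hd'.le y.2.1) (by gcongr)
    (mul_le_of_le_one_right hd'.le x.2.2)
  · rw [Subtype.dist_eq, Real.dist_eq, Real.dist_eq, abs_of_nonneg (sub_nonneg.2 hxy')]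
    refine h.trans (le_of_eq ?_)
    rw [← mul_sub, Real.mul_rpow hd'.le (sub_nonneg.2 hxy'), Real.inv_rpow hd'.le]
    field_simp
  · have := abs_coord_sub_le v hG hv hij hj
    rw [div_eq_inv_mul, Real.mul_rpow (by positivity)
      (sub_nonneg.2 (by exact_mod_cast hij)), ← mul_assoc] at this
    exact this

/-! ### A compact set of space-time interpolations -/

/-- Functions on `[0,1]` that are bounded by `b` and Hölder of exponent `3/4` with constant `b`. -/
def spaceCompact (b : ℝ) : Set C(I, ℝ) :=
  {f | (∀ x, f x ∈ Set.Icc (-b) b) ∧ ∀ x y, dist (f x) (f y) ≤ b * dist x y ^ (3 / 4 : ℝ)}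

theorem isCompact_spaceCompact (b : ℝ) : IsCompact (spaceCompact b) :=
  isCompact_setOf_dist_le_rpow isCompact_Icc b (by norm_num)

/-- Convexity keeps the interpolation in time inside the compact set between the time nodes. -/
theorem convex_spaceCompact (b : ℝ) : Convex ℝ (spaceCompact b) := by
  intro f hf g hg r s hr hs hrs
  refine ⟨fun x => convex_Icc (-b) b (hf.1 x) (hg.1 x) hr hs hrs, fun x y => ?_⟩
  have h1 := hf.2 x y
  have h2 := hg.2 x y
  rw [Real.dist_eq] at *
  have e : (r • f + s • g) x - (r • f + s • g) y = r * (f x - f y) + s * (g x - g y) := by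
    simp only [ContinuousMap.add_apply, ContinuousMap.smul_apply, smul_eq_mul]; ring
  rw [e]
  calc |r * (f x - f y) + s * (g x - g y)| ≤ r * |f x - f y| + s * |g x - g y| := by
        refine (abs_add_le _ _).trans (le_of_eq ?_)
        rw [abs_mul, abs_mul, abs_of_nonneg hr, abs_of_nonneg hs]
    _ ≤ r * (b * dist x y ^ (3 / 4 : ℝ)) + s * (b * dist x y ^ (3 / 4 : ℝ)) := by gcongr
    _ = b * dist x y ^ (3 / 4 : ℝ) := by rw [← add_mul, hrs, one_mul]

theorem spaceInterp_mem_spaceCompact {d : ℕ} (hd : 0 < d) (v : Fin d → ℝ) {G : ℝ} (hG : 0 ≤ G)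
    (hv : energy v ≤ G ^ 4) : spaceInterp v ∈ spaceCompact (3 * G) := by
  refine ⟨fun x => abs_le.1 ?_, dist_spaceInterp_le hd v hG hv⟩
  have := abs_spaceInterp_le hd v hG hv x
  linarith

/-- Paths with values in `spaceCompact b` that are Hölder of exponent `1/8` with constant `b`. -/
def pathCompact (τ b : ℝ) : Set (PathSpace τ) :=
  {f | (∀ s, f s ∈ spaceCompact b) ∧ ∀ s s', dist (f s) (f s') ≤ b * dist s s' ^ (1 / 8 : ℝ)}

theorem isCompact_pathCompact (τ b : ℝ) : IsCompact (pathCompact τ b) :=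
  isCompact_setOf_dist_le_rpow (isCompact_spaceCompact b) b (by norm_num)

/-- Spatial interpolation is linear, so the distance between two time nodes is the sup norm of the
interpolation of `v j - v i`, at most twice the fourth root of the energy bound; the exponent `1/2`
thus becomes `1/8`. The constant `6` is this `2` times the `3` lost in time interpolation. -/
theorem spaceTimeInterp_mem_pathCompact {d : ℕ} (hd : 0 < d) {τ : ℝ} {T N : ℕ} (hT : 0 < T)
    (hN : 0 < N) (hτN : T * τ ≤ N) {v : ℕ → Fin d → ℝ} {G : ℝ} (hG : 0 ≤ G)
    (h1 : ∀ t ≤ N, energy (v t) ≤ G ^ 4)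
    (h2 : ∀ i j, i ≤ j → j ≤ N → energy (v j - v i) ≤ G ^ 4 * (((j : ℝ) - i) / T) ^ (1 / 2 : ℝ)) :
    spaceTimeInterp τ T v ∈ pathCompact τ (6 * G) := by
  have hT' : (0 : ℝ) < T := by exact_mod_cast hT
  have hmono : spaceCompact (3 * G) ⊆ spaceCompact (6 * G) := by
    refine fun f hf => ⟨fun x => ?_, fun x y => (hf.2 x y).trans ?_⟩
    · exact ⟨by linarith [(hf.1 x).1], by linarith [(hf.1 x).2]⟩
    · gcongr; norm_num
  refine ⟨fun s => hmono ?_, fun s s' => ?_⟩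
  · refine linInterp_mem_of_convex (convex_spaceCompact _) hN
      (fun i hi => spaceInterp_mem_spaceCompact hd _ hG (h1 i hi)) (mul_nonneg hT'.le s.2.1) ?_
    exact le_trans (by gcongr; exact s.2.2) hτN
  · wlog hss : s' ≤ s generalizing s s'
    · rw [dist_comm, dist_comm s]
      exact this s' s (le_of_not_ge hss)
    have hss' : (s' : ℝ) ≤ s := hss
    have h := norm_linInterp_sub_le (a := fun t => spaceInterp (v t)) (N := N)
      (H := 2 * G * (T : ℝ)⁻¹ ^ (1 / 8 : ℝ)) (γ := 1 / 8) (by positivity) (by norm_num)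
      (by norm_num) (fun i j hij hj => ?_) hN (u := T * s') (u' := T * s)
      (mul_nonneg hT'.le s'.2.1) (by gcongr) (le_trans (by gcongr; exact s.2.2) hτN)
    · rw [Subtype.dist_eq, Real.dist_eq, dist_eq_norm, abs_of_nonneg (sub_nonneg.2 hss')]
      refine h.trans (le_of_eq ?_)
      rw [← mul_sub, Real.mul_rpow hT'.le (sub_nonneg.2 hss'), Real.inv_rpow hT'.le]
      field_simp
      ring
    · have hij' : (0 : ℝ) ≤ (j : ℝ) - i := sub_nonneg.2 (by exact_mod_cast hij)
      have hr : (0 : ℝ) ≤ ((j : ℝ) - i) / T := by positivity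
      rw [← spaceInterp_sub, mul_assoc, mul_assoc, ← Real.mul_rpow (by positivity) hij',
        ← div_eq_inv_mul, ContinuousMap.norm_le _ (by positivity)]
      intro x
      refine abs_spaceInterp_le hd _ (by positivity) ?_ x
      rw [mul_pow, rpow_pow_four hr]
      norm_num only
      exact h2 i j hij hj

/-! ### Measurability of the interpolated process -/

/-- Hat functions replace the floor: only the nodes `⌊u⌋` and `⌊u⌋ + 1` have nonzero weight, and
every weight is continuous in `u`. Joint continuity in the vector and the point, and with it
measurability, follows. -/
theorem linInterp_eq_sum {V : Type*} [AddCommGroup V] [Module ℝ V] (a : ℕ → V) {u : ℝ} {N : ℕ}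
    (h0 : 0 ≤ u) (h1 : u ≤ N) :
    linInterp a u = ∑ n ∈ Finset.range (N + 2), max 0 (1 - |u - n|) • a n := by
  have h2 := Nat.floor_le h0
  have h3 := Nat.lt_floor_add_one u
  have h4 : ⌊u⌋₊ ≤ N := Nat.floor_le_of_le h1
  rw [← Finset.sum_subset (s₁ := {⌊u⌋₊, ⌊u⌋₊ + 1})]
  · rw [Finset.sum_pair (by omega)]
    push_cast
    rw [abs_of_nonneg (by linarith), abs_of_nonpos (by linarith), max_eq_right (by linarith),
      max_eq_right (by linarith), linInterp]
    congr 2 <;> ring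
  · intro n hn
    simp only [Finset.mem_insert, Finset.mem_singleton] at hn
    exact Finset.mem_range.2 (by omega)
  · intro n _ hn
    simp only [Finset.mem_insert, Finset.mem_singleton, not_or] at hn
    rw [max_eq_left, zero_smul]
    rw [sub_nonpos]
    rcases lt_or_gt_of_ne hn.1 with h | h
    · have : (n : ℝ) + 1 ≤ ⌊u⌋₊ := by exact_mod_cast h
      exact le_trans (by linarith) (le_abs_self _)
    · have h' : ⌊u⌋₊ + 2 ≤ n := by omega
      have : (⌊u⌋₊ : ℝ) + 2 ≤ n := by exact_mod_cast h'
      exact le_trans (by linarith) (neg_le_abs _)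

theorem continuous_coord {d : ℕ} (i : ℕ) : Continuous fun v : Fin d → ℝ => coord v i := by
  unfold coord
  split_ifs <;> fun_prop

theorem continuous_spaceInterp {d : ℕ} : Continuous (spaceInterp : (Fin d → ℝ) → C(I, ℝ)) := by
  refine ContinuousMap.continuous_of_continuous_uncurry _ ?_
  have h : (Function.uncurry fun (v : Fin d → ℝ) (x : I) => spaceInterp v x) = fun p =>
      ∑ n ∈ Finset.range (d + 2), max 0 (1 - |(d : ℝ) * (p.2 : ℝ) - n|) • coord p.1 n := by
    ext ⟨v, x⟩
    exact linInterp_eq_sum _ (mul_nonneg (Nat.cast_nonneg d) x.2.1)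
      (mul_le_of_le_one_right (Nat.cast_nonneg d) x.2.2)
  rw [h]
  refine continuous_finsetSum _ fun n _ => ?_
  have h1 : Continuous fun p : (Fin d → ℝ) × I => max 0 (1 - |(d : ℝ) * (p.2 : ℝ) - n|) := by
    fun_prop
  exact h1.smul ((continuous_coord n).comp continuous_fst)

theorem continuous_spaceTimeInterp {d : ℕ} (τ : ℝ) (T : ℕ) :
    Continuous (spaceTimeInterp τ T : (ℕ → Fin d → ℝ) → PathSpace τ) := by
  refine ContinuousMap.continuous_of_continuous_uncurry _ ?_
  obtain ⟨N, hN⟩ := exists_nat_ge (T * τ)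
  have h : (Function.uncurry fun (v : ℕ → Fin d → ℝ) (s : Set.Icc (0 : ℝ) τ) =>
      spaceTimeInterp τ T v s) = fun p =>
      ∑ n ∈ Finset.range (N + 2), max 0 (1 - |(T : ℝ) * (p.2 : ℝ) - n|) • spaceInterp (p.1 n) := by
    ext1 ⟨v, s⟩
    refine linInterp_eq_sum (fun t => spaceInterp (v t)) (mul_nonneg (Nat.cast_nonneg T) s.2.1)
      (le_trans ?_ hN)
    exact mul_le_mul_of_nonneg_left s.2.2 (Nat.cast_nonneg T)
  rw [h]
  refine continuous_finsetSum _ fun n _ => ?_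
  have h1 : Continuous fun p : (ℕ → Fin d → ℝ) × Set.Icc (0 : ℝ) τ =>
      max 0 (1 - |(T : ℝ) * (p.2 : ℝ) - n|) := by fun_prop
  exact h1.smul <| continuous_spaceInterp.comp ((continuous_apply n).comp continuous_fst)

theorem measurable_sgd {Ω : Type*} [MeasurableSpace Ω] {d : ℕ} (η : ℝ) {x : Ω → ℕ → Fin d → ℝ}
    {y : Ω → ℕ → ℝ} {θ₀ : Ω → Fin d → ℝ} (hx : ∀ t, Measurable fun ω => x ω t)
    (hy : ∀ t, Measurable fun ω => y ω t) (hθ : Measurable θ₀) (t : ℕ) :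
    Measurable fun ω => sgd η (x ω) (y ω) (θ₀ ω) t := by
  induction t with
  | zero => exact hθ
  | succ t ih =>
    have h1 : Measurable fun ω => x ω t ⬝ᵥ sgd η (x ω) (y ω) (θ₀ ω) t := by
      unfold dotProduct
      refine Finset.measurable_sum _ fun i _ => ?_
      exact ((measurable_pi_apply i).comp (hx t)).mul ((measurable_pi_apply i).comp ih)
    exact ih.add ((((hy t).sub h1).const_mul η).smul (hx t))

theorem measurable_sample {Ω : Type*} [MeasurableSpace Ω] (d T : ℕ) {W : ℝ≥0 → I → Ω → ℝ}
    (hW : ∀ s x, Measurable (W s x)) (t : ℕ) : Measurable fun ω => sample d T W ω t :=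
  measurable_pi_lambda _ fun _ => hW _ _

theorem measurable_centeredIterate {Ω : Type*} [MeasurableSpace Ω] (d T : ℕ) (η : ℝ)
    {W : ℝ≥0 → I → Ω → ℝ} {ε : ℕ → Ω → ℝ} {θstar : Fin d → ℝ} {θ₀ : Ω → Fin d → ℝ}
    (hW : ∀ s x, Measurable (W s x)) (hε : ∀ t, Measurable (ε t)) (hθ : Measurable θ₀) (t : ℕ) :
    Measurable fun ω => centeredIterate d T η W ε θstar θ₀ ω t := by
  refine (measurable_sgd η (measurable_sample d T hW) (fun t => ?_) hθ t).sub_const θstar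
  refine Measurable.add ?_ (hε t)
  unfold dotProduct
  refine Finset.measurable_sum _ fun i _ => ?_
  exact ((measurable_pi_apply i).comp (measurable_sample d T hW t)).mul_const _

theorem measurable_interpolatedSGD {Ω : Type*} [MeasurableSpace Ω] (τ : ℝ) (d T : ℕ) (η : ℝ)
    {W : ℝ≥0 → I → Ω → ℝ} {ε : ℕ → Ω → ℝ} {θstar : Fin d → ℝ} {θ₀ : Ω → Fin d → ℝ}
    (hW : ∀ s x, Measurable (W s x)) (hε : ∀ t, Measurable (ε t)) (hθ : Measurable θ₀) :
    Measurable (interpolatedSGD τ d T η W ε θstar θ₀) :=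
  (continuous_spaceTimeInterp τ T).measurable.comp
    (measurable_pi_lambda _ fun t => measurable_centeredIterate d T η hW hε hθ t)

/-! ### Fourth moment of one step of the recursion -/

/-- Cauchy-Schwarz with weights `|w j|`. The sum costs only the `ℓ¹` norm of `w`, so moment bounds
for it do not see the dimension. -/
theorem sq_sum_mul_le {d : ℕ} (w x : Fin d → ℝ) :
    (∑ j, w j * x j) ^ 2 ≤ (∑ j, |w j|) * ∑ j, |w j| * x j ^ 2 := by
  refine Finset.sum_sq_le_sum_mul_sum_of_sq_le_mul _ (fun j _ => abs_nonneg _)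
    (fun j _ => by positivity) (fun j _ => le_of_eq ?_)
  rw [← mul_assoc, ← sq, sq_abs, mul_pow]

theorem pow_four_sum_mul_le {d : ℕ} (w x : Fin d → ℝ) :
    (∑ j, w j * x j) ^ 4 ≤ (∑ j, |w j|) ^ 3 * ∑ j, |w j| * x j ^ 4 := by
  have h1 := sq_sum_mul_le w x
  have h2 := sq_sum_mul_le (fun j => |w j|) (fun j => x j ^ 2)
  simp only [abs_abs, ← pow_mul, Nat.reduceMul] at h2
  have h0 : 0 ≤ ∑ j, |w j| := Finset.sum_nonneg fun j _ => abs_nonneg _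
  calc (∑ j, w j * x j) ^ 4 = ((∑ j, w j * x j) ^ 2) ^ 2 := by ring
    _ ≤ ((∑ j, |w j|) * ∑ j, |w j| * x j ^ 2) ^ 2 := by gcongr
    _ = (∑ j, |w j|) ^ 2 * (∑ j, |w j| * x j ^ 2) ^ 2 := by ring
    _ ≤ (∑ j, |w j|) ^ 2 * ((∑ j, |w j|) * ∑ j, |w j| * x j ^ 4) := by gcongr
    _ = _ := by ring

/-- The moment conditions on a linear functional `ℓ` of a random vector `ξ` under which the fourth
moment of `ℓ` grows slowly along the recursion driven by copies of `ξ`. -/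
structure MomentBound {Ω : Type*} [MeasurableSpace Ω] (P : Measure Ω) {d : ℕ}
    (ξ : Ω → Fin d → ℝ) (K : ℝ) (ℓ : (Fin d → ℝ) →ₗ[ℝ] ℝ) : Prop where
  mean : ∫ ω, ℓ (ξ ω) ∂P = 0
  integrable_four : Integrable (fun ω => ℓ (ξ ω) ^ 4) P
  four : ∫ ω, ℓ (ξ ω) ^ 4 ∂P ≤ K
  integrable_eight : ∀ j, Integrable (fun ω => (ℓ (ξ ω) * ξ ω j) ^ 4) P
  eight : ∀ j, ∫ ω, (ℓ (ξ ω) * ξ ω j) ^ 4 ∂P ≤ K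

/-- The upper bound for the conditional fourth moment after one step from the value `y`, where
`n` is the noise and `S` the `ℓ¹` norm of the drift weights. -/
noncomputable def stepBound (K y n S : ℝ) : ℝ :=
  y ^ 4 + 24 * K * (|y| ^ 3 * S + y ^ 2 * n ^ 2 + y ^ 2 * S ^ 2 + n ^ 4 + S ^ 4)

section Moments

variable {Ω : Type*} [MeasurableSpace Ω] {P : Measure Ω} [IsProbabilityMeasure P]

theorem integrable_pow_of_pow_four {X : Ω → ℝ} (hX : Measurable X)
    (h : Integrable (fun ω => X ω ^ 4) P) : Integrable X P ∧ Integrable (fun ω => X ω ^ 2) P := by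
  have h1 : Integrable (fun ω => X ω ^ 4 + 1) P := h.add (integrable_const _)
  refine ⟨h1.mono' hX.aestronglyMeasurable (ae_of_all _ fun ω => ?_),
    h1.mono' (hX.pow_const 2).aestronglyMeasurable (ae_of_all _ fun ω => ?_)⟩
  · rw [Real.norm_eq_abs, abs_le]
    constructor <;> nlinarith [sq_nonneg (X ω ^ 2 - 1), sq_nonneg (X ω - 1), sq_nonneg (X ω + 1)]
  · rw [Real.norm_of_nonneg (sq_nonneg _)]
    nlinarith [sq_nonneg (X ω ^ 2 - 1)]

/-- Each lower moment is at most the mean of `1` and the moment of twice its order, so with `1 ≤ K`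
one constant bounds them all without roots. -/
theorem integral_le_of_pow_four {X : Ω → ℝ} (hX : Measurable X)
    (h : Integrable (fun ω => X ω ^ 4) P) {K : ℝ} (hK : 1 ≤ K) (hXK : ∫ ω, X ω ^ 4 ∂P ≤ K) :
    |∫ ω, X ω ∂P| ≤ K ∧ ∫ ω, X ω ^ 2 ∂P ≤ K := by
  obtain ⟨h1, h2⟩ := integrable_pow_of_pow_four hX h
  have h3 : ∫ ω, (X ω ^ 4 + 1) / 2 ∂P ≤ K := by
    rw [integral_div, integral_add h (integrable_const _)]
    simp only [integral_const, probReal_univ, smul_eq_mul, mul_one]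
    linarith
  have h4 : ∫ ω, X ω ^ 2 ∂P ≤ K := by
    refine le_trans (integral_mono h2 ((h.add (integrable_const _)).div_const _) fun ω => ?_) h3
    simp only [Pi.add_apply]
    nlinarith [sq_nonneg (X ω ^ 2 - 1)]
  refine ⟨(abs_integral_le_integral_abs).trans ?_, h4⟩
  have h5 : ∫ ω, (X ω ^ 2 + 1) / 2 ∂P ≤ K := by
    rw [integral_div, integral_add h2 (integrable_const _)]
    simp only [integral_const, probReal_univ, smul_eq_mul, mul_one]
    linarith
  refine le_trans (integral_mono h1.abs ((h2.add (integrable_const _)).div_const _) fun ω => ?_) h5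
  simp only [Pi.add_apply]
  nlinarith [sq_nonneg (|X ω| - 1), sq_abs (X ω)]

/-- With `X = ℓ(ξ)` and `Z = X ∑ w_j ξ_j` the increment is `X n - Z`. The mean of `X` vanishes, so
the only surviving first-order term is that of `Z`, at most `K S` in mean; all other terms are at
least quadratic in `n` and `S`. -/
theorem lintegral_step_le {d : ℕ} {ξ : Ω → Fin d → ℝ} (hξ : Measurable ξ) {K : ℝ} (hK : 1 ≤ K)
    {ℓ : (Fin d → ℝ) →ₗ[ℝ] ℝ} (hℓ : MomentBound P ξ K ℓ) (y n : ℝ) (w : Fin d → ℝ) :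
    ∫⁻ ω, ENNReal.ofReal ((y + ℓ (ξ ω) * (n - ∑ j, w j * ξ ω j)) ^ 4) ∂P
      ≤ ENNReal.ofReal (stepBound K y n (∑ j, |w j|)) := by
  have hX : Measurable fun ω => ℓ (ξ ω) := ℓ.continuous_of_finiteDimensional.measurable.comp hξ
  have hXj : ∀ j, Measurable fun ω => ℓ (ξ ω) * ξ ω j := fun j =>
    hX.mul ((measurable_pi_apply j).comp hξ)
  set S := ∑ j, |w j| with hS
  have hS0 : 0 ≤ S := Finset.sum_nonneg fun j _ => abs_nonneg _
  obtain ⟨i1, i2⟩ := integrable_pow_of_pow_four hX hℓ.integrable_four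
  have j1 := fun j => (integrable_pow_of_pow_four (hXj j) (hℓ.integrable_eight j)).1
  have j2 := fun j => (integrable_pow_of_pow_four (hXj j) (hℓ.integrable_eight j)).2
  have k2 := (integral_le_of_pow_four hX hℓ.integrable_four hK hℓ.four).2
  have l1 := fun j => (integral_le_of_pow_four (hXj j) (hℓ.integrable_eight j) hK (hℓ.eight j)).1
  have l2 := fun j => (integral_le_of_pow_four (hXj j) (hℓ.integrable_eight j) hK (hℓ.eight j)).2
  let g1 : Ω → ℝ := fun ω => 4 * y ^ 3 * n * ℓ (ξ ω)
  let g2 : Ω → ℝ := fun ω => 4 * y ^ 3 * ∑ j, w j * (ℓ (ξ ω) * ξ ω j)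
  let g3 : Ω → ℝ := fun ω => 16 * y ^ 2 * n ^ 2 * ℓ (ξ ω) ^ 2
  let g4 : Ω → ℝ := fun ω => 16 * y ^ 2 * S * ∑ j, |w j| * (ℓ (ξ ω) * ξ ω j) ^ 2
  let g5 : Ω → ℝ := fun ω => 24 * n ^ 4 * ℓ (ξ ω) ^ 4
  let g6 : Ω → ℝ := fun ω => 24 * S ^ 3 * ∑ j, |w j| * (ℓ (ξ ω) * ξ ω j) ^ 4
  have I1 : Integrable g1 P := i1.const_mul _
  have I2 : Integrable g2 P := (integrable_finsetSum _ fun j _ => (j1 j).const_mul _).const_mul _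
  have I3 : Integrable g3 P := i2.const_mul _
  have I4 : Integrable g4 P := (integrable_finsetSum _ fun j _ => (j2 j).const_mul _).const_mul _
  have I5 : Integrable g5 P := hℓ.integrable_four.const_mul _
  have I6 : Integrable g6 P :=
    (integrable_finsetSum _ fun j _ => (hℓ.integrable_eight j).const_mul _).const_mul _
  have hpt : ∀ ω, (y + ℓ (ξ ω) * (n - ∑ j, w j * ξ ω j)) ^ 4
      ≤ y ^ 4 + g1 ω - g2 ω + g3 ω + g4 ω + g5 ω + g6 ω := by
    intro ω
    have e2 : g2 ω = 4 * y ^ 3 * (ℓ (ξ ω) * ∑ j, w j * ξ ω j) := by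
      simp only [g2]
      congr 1
      rw [Finset.mul_sum]
      exact Finset.sum_congr rfl fun j _ => by ring
    have e4 : 16 * y ^ 2 * (ℓ (ξ ω) * ∑ j, w j * ξ ω j) ^ 2 ≤ g4 ω := by
      simp only [g4, mul_pow, mul_left_comm |w _|]
      rw [← Finset.mul_sum, mul_assoc _ S, mul_left_comm S]
      gcongr
      exact sq_sum_mul_le _ _
    have e6 : 24 * (ℓ (ξ ω) * ∑ j, w j * ξ ω j) ^ 4 ≤ g6 ω := by
      simp only [g6, mul_pow, mul_left_comm |w _|]
      rw [← Finset.mul_sum, mul_assoc _ (S ^ 3), mul_left_comm (S ^ 3)]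
      gcongr
      exact pow_four_sum_mul_le _ _
    simp only [g1, g3, g5, e2]
    set X := ℓ (ξ ω)
    set Z := X * ∑ j, w j * ξ ω j with hZ
    have e : X * (n - ∑ j, w j * ξ ω j) = X * n - Z := by rw [hZ]; ring
    rw [e]
    set U := X * n - Z
    -- The two sides differ by `2 * U ^ 2 * (y - U) ^ 2`; this absorbs the cubic term `4 * y * U ^
    -- 3`.
    have f1 : (y + U) ^ 4 ≤ y ^ 4 + 4 * y ^ 3 * U + 8 * y ^ 2 * U ^ 2 + 3 * U ^ 4 := by
      nlinarith [mul_nonneg (sq_nonneg U) (sq_nonneg (y - U))]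
    have f2 : U ^ 2 ≤ 2 * ((X * n) ^ 2 + Z ^ 2) := by
      nlinarith [sq_nonneg (X * n + Z)]
    have f3 : U ^ 4 ≤ 8 * ((X * n) ^ 4 + Z ^ 4) := by
      have := add_pow_four_le (X * n) (-Z)
      simpa only [Even.pow_abs (show Even 4 by decide), ← sub_eq_add_neg,
        Even.neg_pow (show Even 4 by decide)] using this
    have f4 : 8 * y ^ 2 * U ^ 2 ≤ 8 * y ^ 2 * (2 * ((X * n) ^ 2 + Z ^ 2)) := by gcongr
    have f5 : 4 * y ^ 3 * U = 4 * y ^ 3 * n * X - 4 * y ^ 3 * Z := by simp only [U]; ring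
    calc (y + U) ^ 4 ≤ y ^ 4 + 4 * y ^ 3 * U + 8 * y ^ 2 * U ^ 2 + 3 * U ^ 4 := f1
      _ ≤ y ^ 4 + (4 * y ^ 3 * n * X - 4 * y ^ 3 * Z) + 8 * y ^ 2 * (2 * ((X * n) ^ 2 + Z ^ 2))
          + 3 * (8 * ((X * n) ^ 4 + Z ^ 4)) := by rw [f5]; gcongr
      _ = y ^ 4 + 4 * y ^ 3 * n * X - 4 * y ^ 3 * Z + 16 * y ^ 2 * n ^ 2 * X ^ 2
          + 16 * y ^ 2 * Z ^ 2 + 24 * n ^ 4 * X ^ 4 + 24 * Z ^ 4 := by ring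
      _ ≤ _ := by gcongr
  have J1 : Integrable (fun ω => y ^ 4 + g1 ω) P := (integrable_const _).add I1
  have J2 : Integrable (fun ω => y ^ 4 + g1 ω - g2 ω) P := J1.sub I2
  have J3 : Integrable (fun ω => y ^ 4 + g1 ω - g2 ω + g3 ω) P := J2.add I3
  have J4 : Integrable (fun ω => y ^ 4 + g1 ω - g2 ω + g3 ω + g4 ω) P := J3.add I4
  have J5 : Integrable (fun ω => y ^ 4 + g1 ω - g2 ω + g3 ω + g4 ω + g5 ω) P := J4.add I5
  have hI : Integrable (fun ω => y ^ 4 + g1 ω - g2 ω + g3 ω + g4 ω + g5 ω + g6 ω) P := J5.add I6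
  calc ∫⁻ ω, ENNReal.ofReal ((y + ℓ (ξ ω) * (n - ∑ j, w j * ξ ω j)) ^ 4) ∂P
      ≤ ∫⁻ ω, ENNReal.ofReal (y ^ 4 + g1 ω - g2 ω + g3 ω + g4 ω + g5 ω + g6 ω) ∂P :=
        lintegral_mono fun ω => ENNReal.ofReal_le_ofReal (hpt ω)
    _ = ENNReal.ofReal (∫ ω, (y ^ 4 + g1 ω - g2 ω + g3 ω + g4 ω + g5 ω + g6 ω) ∂P) :=
        (ofReal_integral_eq_lintegral_ofReal hI
          (ae_of_all _ fun ω => le_trans (by positivity) (hpt ω))).symm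
    _ ≤ _ := ENNReal.ofReal_le_ofReal ?_
  have hint : ∫ ω, (y ^ 4 + g1 ω - g2 ω + g3 ω + g4 ω + g5 ω + g6 ω) ∂P
      = y ^ 4 + ∫ ω, g1 ω ∂P - ∫ ω, g2 ω ∂P + ∫ ω, g3 ω ∂P + ∫ ω, g4 ω ∂P + ∫ ω, g5 ω ∂P
        + ∫ ω, g6 ω ∂P := by
    rw [integral_add J5 I6, integral_add J4 I5, integral_add J3 I4, integral_add J2 I3,
      integral_sub J1 I2, integral_add (integrable_const _) I1]
    simp
  rw [hint]
  have E1 : ∫ ω, g1 ω ∂P = 0 := by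
    simp only [g1, integral_const_mul, hℓ.mean, mul_zero]
  have E2 : - ∫ ω, g2 ω ∂P ≤ 4 * |y| ^ 3 * (K * S) := by
    refine (neg_le_abs _).trans ?_
    simp only [g2, integral_const_mul]
    rw [integral_finsetSum _ fun j _ => (j1 j).const_mul _, abs_mul, abs_mul, abs_pow]
    simp only [integral_const_mul, Nat.abs_ofNat]
    gcongr
    refine (Finset.abs_sum_le_sum_abs _ _).trans ?_
    rw [hS, Finset.mul_sum]
    refine Finset.sum_le_sum fun j _ => ?_
    rw [abs_mul, mul_comm]
    gcongr
    exact l1 j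
  have E3 : ∫ ω, g3 ω ∂P ≤ 16 * y ^ 2 * n ^ 2 * K := by
    simp only [g3, integral_const_mul]
    gcongr
  have hsum : ∀ F : Fin d → Ω → ℝ, (∀ j, Integrable (F j) P) → (∀ j, ∫ ω, F j ω ∂P ≤ K) →
      ∫ ω, ∑ j, |w j| * F j ω ∂P ≤ S * K := by
    intro F hF hFK
    rw [integral_finsetSum _ fun j _ => (hF j).const_mul _, hS, Finset.sum_mul]
    refine Finset.sum_le_sum fun j _ => ?_
    rw [integral_const_mul]
    gcongr
    exact hFK j
  have E4 : ∫ ω, g4 ω ∂P ≤ 16 * y ^ 2 * S * (S * K) := by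
    simp only [g4, integral_const_mul]
    gcongr
    exact hsum _ j2 l2
  have E5 : ∫ ω, g5 ω ∂P ≤ 24 * n ^ 4 * K := by
    simp only [g5, integral_const_mul]
    gcongr
    exact hℓ.four
  have E6 : ∫ ω, g6 ω ∂P ≤ 24 * S ^ 3 * (S * K) := by
    simp only [g6, integral_const_mul]
    gcongr
    exact hsum _ hℓ.integrable_eight hℓ.eight
  have q1 : 0 ≤ K * (|y| ^ 3 * S) := by positivity
  have q2 : 0 ≤ K * (y ^ 2 * n ^ 2) := by positivity
  have q3 : 0 ≤ K * (y ^ 2 * S ^ 2) := by positivity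
  unfold stepBound
  nlinarith

/-- By independence the joint law is a product, and Tonelli reduces the claim to `lintegral_step_le`
with the past `ζ` frozen. Integrals in `[0,∞]` yield integrability of the new fourth power together
with its bound. -/
theorem integral_step_le {d : ℕ} {Z : Type*} [MeasurableSpace Z] {ζ : Ω → Z} (hζ : Measurable ζ)
    {ξ : Ω → Fin d → ℝ} (hξ : Measurable ξ) (hind : IndepFun ζ ξ P) {K : ℝ} (hK : 1 ≤ K)
    {ℓ : (Fin d → ℝ) →ₗ[ℝ] ℝ} (hℓ : MomentBound P ξ K ℓ) {y n : Z → ℝ} {w : Z → Fin d → ℝ}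
    (hy : Measurable y) (hn : Measurable n) (hw : Measurable w) {g : Ω → ℝ} (hg : Integrable g P)
    (hle : ∀ ω, stepBound K (y (ζ ω)) (n (ζ ω)) (∑ j, |w (ζ ω) j|) ≤ g ω) :
    Integrable (fun ω => (y (ζ ω) + ℓ (ξ ω) * (n (ζ ω) - ∑ j, w (ζ ω) j * ξ ω j)) ^ 4) P ∧
    ∫ ω, (y (ζ ω) + ℓ (ξ ω) * (n (ζ ω) - ∑ j, w (ζ ω) j * ξ ω j)) ^ 4 ∂P ≤ ∫ ω, g ω ∂P := by
  have hℓm : Measurable ℓ := ℓ.continuous_of_finiteDimensional.measurable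
  let F : Z × (Fin d → ℝ) → ℝ := fun p =>
    (y p.1 + ℓ p.2 * (n p.1 - ∑ j, w p.1 j * p.2 j)) ^ 4
  have hF : Measurable F := by
    refine Measurable.pow_const ?_ 4
    refine (hy.comp measurable_fst).add ((hℓm.comp measurable_snd).mul
      ((hn.comp measurable_fst).sub (Finset.measurable_sum _ fun j _ => ?_)))
    exact ((measurable_pi_apply j).comp (hw.comp measurable_fst)).mul
      ((measurable_pi_apply j).comp measurable_snd)
  have hF0 : ∀ p, 0 ≤ F p := fun p => by positivity
  have hsb : ∀ y n S : ℝ, 0 ≤ S → 0 ≤ stepBound K y n S := by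
    intro y n S hS
    unfold stepBound
    positivity
  have hg0 : ∀ ω, 0 ≤ g ω := fun ω =>
    (hsb _ _ _ (Finset.sum_nonneg fun j _ => abs_nonneg _)).trans (hle ω)
  have hlin : ∫⁻ ω, ENNReal.ofReal (F (ζ ω, ξ ω)) ∂P ≤ ENNReal.ofReal (∫ ω, g ω ∂P) := by
    have h1 : ∫⁻ ω, ENNReal.ofReal (F (ζ ω, ξ ω)) ∂P
        = ∫⁻ p, ENNReal.ofReal (F p) ∂(P.map fun ω => (ζ ω, ξ ω)) :=
      (lintegral_map hF.ennreal_ofReal (hζ.prodMk hξ)).symm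
    rw [h1, (indepFun_iff_map_prod_eq_prod_map_map hζ.aemeasurable hξ.aemeasurable).1 hind]
    have : IsProbabilityMeasure (P.map ξ) := Measure.isProbabilityMeasure_map hξ.aemeasurable
    rw [lintegral_prod _ hF.ennreal_ofReal.aemeasurable,
      lintegral_map hF.ennreal_ofReal.lintegral_prod_right' hζ,
      ofReal_integral_eq_lintegral_ofReal hg (ae_of_all _ hg0)]
    refine lintegral_mono fun ω => ?_
    have h2 : ∫⁻ x, ENNReal.ofReal (F (ζ ω, x)) ∂(P.map ξ)
        = ∫⁻ ω', ENNReal.ofReal (F (ζ ω, ξ ω')) ∂P :=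
      lintegral_map (hF.comp measurable_prodMk_left).ennreal_ofReal hξ
    rw [h2]
    exact (lintegral_step_le hξ hK hℓ _ _ _).trans (ENNReal.ofReal_le_ofReal (hle ω))
  have hFint : Integrable (fun ω => F (ζ ω, ξ ω)) P := by
    refine ⟨(hF.comp (hζ.prodMk hξ)).aestronglyMeasurable, ?_⟩
    rw [hasFiniteIntegral_iff_ofReal (ae_of_all _ fun ω => hF0 _)]
    exact hlin.trans_lt ENNReal.ofReal_lt_top
  refine ⟨hFint, ?_⟩
  rw [← ENNReal.ofReal_le_ofReal_iff (integral_nonneg hg0),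
    ofReal_integral_eq_lintegral_ofReal hFint (ae_of_all _ fun ω => hF0 _)]
  exact hlin

end Moments

/-! ### Moments of linear functionals of the samples -/

/-- The coordinate functional `v ↦ coord v i`. -/
def coordL (d i : ℕ) : (Fin d → ℝ) →ₗ[ℝ] ℝ where
  toFun v := coord v i
  map_add' v w := by unfold coord; split_ifs <;> simp
  map_smul' c v := by unfold coord; split_ifs <;> simp

/-- The difference quotient functional `v ↦ d (coord v (k + 1) - coord v k)`. -/
noncomputable def slopeL (d k : ℕ) : (Fin d → ℝ) →ₗ[ℝ] ℝ :=
  (d : ℝ) • (coordL d (k + 1) - coordL d k)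

theorem coordL_apply (d i : ℕ) (v : Fin d → ℝ) : coordL d i v = coord v i := rfl

theorem slopeL_apply (d k : ℕ) (v : Fin d → ℝ) :
    slopeL d k v = d * (coord v (k + 1) - coord v k) := rfl

/-- Pointwise, the product is at most `M ^ n ≤ 1 + M ^ 8`, where `M` is the largest absolute value
of a factor. -/
theorem integrable_prod_of_memLp_eight {Ω : Type*} [MeasurableSpace Ω] {P : Measure Ω}
    [IsFiniteMeasure P] {n : ℕ} (hn : n ≤ 8) {f : Fin n → Ω → ℝ} (hf : ∀ i, MemLp (f i) 8 P) :
    Integrable (fun ω => ∏ i, f i ω) P := by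
  have h8 : ∀ i, Integrable (fun ω => |f i ω| ^ 8) P := fun i => by
    have := (hf i).integrable_norm_pow (p := 8) (by norm_num)
    simpa using this
  have hm : Integrable (fun ω => 1 + ∑ i, |f i ω| ^ 8) P :=
    (integrable_const _).add (integrable_finsetSum _ fun i _ => h8 i)
  refine hm.mono' ?_ (ae_of_all _ fun ω => ?_)
  · exact Finset.aestronglyMeasurable_fun_prod _ fun i _ => (hf i).1
  · rw [Real.norm_eq_abs, Finset.abs_prod]
    have hs : ∀ i, |f i ω| ^ 8 ≤ ∑ i, |f i ω| ^ 8 := fun i =>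
      Finset.single_le_sum (f := fun i => |f i ω| ^ 8) (fun _ _ => by positivity)
        (Finset.mem_univ i)
    rcases Nat.eq_zero_or_pos n with rfl | h0
    · simp
    obtain ⟨j, -, hj⟩ := Finset.exists_max_image Finset.univ (fun i => |f i ω|)
      ⟨(⟨0, h0⟩ : Fin n), Finset.mem_univ _⟩
    have h1 : ∏ i, |f i ω| ≤ |f j ω| ^ n := by
      refine (Finset.prod_le_prod (fun i _ => abs_nonneg (f i ω)) hj).trans (le_of_eq ?_)
      rw [Finset.prod_const, Finset.card_univ, Fintype.card_fin]
    have h2 : |f j ω| ^ n ≤ 1 + |f j ω| ^ 8 := by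
      rcases le_total |f j ω| 1 with h | h
      · exact (pow_le_one₀ (abs_nonneg _) h).trans (by simp)
      · exact (pow_le_pow_right₀ h hn).trans (by simp)
    exact h1.trans (h2.trans (by gcongr; exact hs j))

theorem coord_sample {Ω : Type*} {W : ℝ≥0 → I → Ω → ℝ} {d : ℕ} (T : ℕ) (ω : Ω) (t : ℕ) {i : ℕ} (hi : i - 1 < d) :
    coord (sample d T W ω t) i = W ((t : ℝ≥0) / T) (gridPoint ⟨i - 1, hi⟩) ω := by
  simp only [coord, hi, dif_pos, sample]

theorem integral_fourth_difference {Ω : Type*} [MeasurableSpace Ω] {P : Measure Ω} 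
    {f₁ f₂ f₃ f₄ f₅ : Ω → ℝ} (h₁ : Integrable f₁ P)
    (h₂ : Integrable f₂ P) (h₃ : Integrable f₃ P) (h₄ : Integrable f₄ P) (h₅ : Integrable f₅ P) :
    Integrable (fun ω => f₁ ω + f₂ ω + 6 * f₃ ω - 4 * f₄ ω - 4 * f₅ ω) P ∧
    ∫ ω, (f₁ ω + f₂ ω + 6 * f₃ ω - 4 * f₄ ω - 4 * f₅ ω) ∂P
      = ∫ ω, f₁ ω ∂P + ∫ ω, f₂ ω ∂P + 6 * ∫ ω, f₃ ω ∂P - 4 * ∫ ω, f₄ ω ∂P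
        - 4 * ∫ ω, f₅ ω ∂P := by
  have i2 : Integrable (fun ω => f₁ ω + f₂ ω) P := h₁.add h₂
  have i3 : Integrable (fun ω => f₁ ω + f₂ ω + 6 * f₃ ω) P := i2.add (h₃.const_mul 6)
  have i4 : Integrable (fun ω => f₁ ω + f₂ ω + 6 * f₃ ω - 4 * f₄ ω) P := i3.sub (h₄.const_mul 4)
  refine ⟨i4.sub (h₅.const_mul 4), ?_⟩
  rw [integral_sub i4 (h₅.const_mul 4), integral_sub i3 (h₄.const_mul 4),
    integral_add i2 (h₃.const_mul 6), integral_add h₁ h₂]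
  simp only [integral_const_mul]

section Data

variable {Ω : Type*} [MeasurableSpace Ω] {P : Measure Ω} [IsProbabilityMeasure P]
  {W : ℝ≥0 → I → Ω → ℝ} {A : I → I → ℝ} {B : (Fin 4 → I) → ℝ} {E : (Fin 8 → I) → ℝ}

theorem IsDataProcess.integrable_four (hW : IsDataProcess P W A B E) (s : ℝ≥0) (x : Fin 4 → I) :
    Integrable (fun ω => ∏ i, W s (x i) ω) P :=
  integrable_prod_of_memLp_eight (by norm_num) fun i => hW.memLp s (x i)

theorem IsDataProcess.integrable_eight (hW : IsDataProcess P W A B E) (s : ℝ≥0)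
    (x : Fin 8 → I) : Integrable (fun ω => ∏ i, W s (x i) ω) P :=
  integrable_prod_of_memLp_eight le_rfl fun i => hW.memLp s (x i)

theorem IsDataProcess.hasMoment_four (hW : IsDataProcess P W A B E) (s : ℝ≥0) (x : I) :
    Integrable (fun ω => W s x ω ^ 4) P ∧ ∫ ω, W s x ω ^ 4 ∂P = B ![x, x, x, x] := by
  have e : (fun ω => W s x ω ^ 4) = fun ω => ∏ i, W s (![x, x, x, x] i) ω := by
    ext ω
    simp only [Fin.prod_univ_four, Matrix.cons_val]
    ring
  rw [e]
  exact ⟨hW.integrable_four s _, hW.moment_four s _⟩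

theorem IsDataProcess.hasMoment_eight (hW : IsDataProcess P W A B E) (s : ℝ≥0) (x z : I) :
    Integrable (fun ω => (W s x ω * W s z ω) ^ 4) P ∧
      ∫ ω, (W s x ω * W s z ω) ^ 4 ∂P = E ![x, x, x, x, z, z, z, z] := by
  have e : (fun ω => (W s x ω * W s z ω) ^ 4)
      = fun ω => ∏ i, W s (![x, x, x, x, z, z, z, z] i) ω := by
    ext ω
    simp only [Fin.prod_univ_eight, Matrix.cons_val]
    ring
  rw [e]
  exact ⟨hW.integrable_eight s _, hW.moment_eight s _⟩

theorem IsDataProcess.hasMoment_four_sub (hW : IsDataProcess P W A B E) (s : ℝ≥0) (x y : I) :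
    Integrable (fun ω => (W s x ω - W s y ω) ^ 4) P ∧
      ∫ ω, (W s x ω - W s y ω) ^ 4 ∂P = B ![x, x, x, x] + B ![y, y, y, y] + 6 * B ![x, x, y, y]
        - 4 * B ![x, x, x, y] - 4 * B ![x, y, y, y] := by
  have h := integral_fourth_difference (hW.integrable_four s ![x, x, x, x])
    (hW.integrable_four s ![y, y, y, y]) (hW.integrable_four s ![x, x, y, y])
    (hW.integrable_four s ![x, x, x, y]) (hW.integrable_four s ![x, y, y, y])
  simp only [hW.moment_four] at h
  refine cast ?_ h
  congr! 5 with ω ω <;>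
  · simp only [Fin.prod_univ_four, Matrix.cons_val]
    ring

theorem IsDataProcess.hasMoment_eight_sub (hW : IsDataProcess P W A B E) (s : ℝ≥0) (x y z : I) :
    Integrable (fun ω => ((W s x ω - W s y ω) * W s z ω) ^ 4) P ∧
      ∫ ω, ((W s x ω - W s y ω) * W s z ω) ^ 4 ∂P
        = E ![x, x, x, x, z, z, z, z] + E ![y, y, y, y, z, z, z, z]
          + 6 * E ![x, x, y, y, z, z, z, z] - 4 * E ![x, x, x, y, z, z, z, z]
          - 4 * E ![x, y, y, y, z, z, z, z] := by
  have h := integral_fourth_difference (hW.integrable_eight s ![x, x, x, x, z, z, z, z])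
    (hW.integrable_eight s ![y, y, y, y, z, z, z, z])
    (hW.integrable_eight s ![x, x, y, y, z, z, z, z])
    (hW.integrable_eight s ![x, x, x, y, z, z, z, z])
    (hW.integrable_eight s ![x, y, y, y, z, z, z, z])
  simp only [hW.moment_eight] at h
  refine cast ?_ h
  congr! 5 with ω ω <;>
  · simp only [Fin.prod_univ_eight, Matrix.cons_val]
    ring

/-- The fourth differences of `B` and `E` are the fourth moments of `W(x) - W(y)` and of `(W(x) -
W(y)) W(z)`. At spacing `1/d` their smoothness bounds cancel the factor `d ^ 4` of the difference
quotient, leaving a `K` free of `d` and `T`. -/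
theorem exists_momentBound (hABE : SmoothMoments A B E) :
    ∃ K : ℝ, 1 ≤ K ∧ ∀ {Ω : Type*} [MeasurableSpace Ω] (P : Measure Ω) [IsProbabilityMeasure P]
      (W : ℝ≥0 → I → Ω → ℝ), IsDataProcess P W A B E → ∀ d T : ℕ, 0 < d → ∀ t i : ℕ, i < d →
        MomentBound P (fun ω => sample d T W ω t) K (coordL d (i + 1)) ∧
        MomentBound P (fun ω => sample d T W ω t) K (slopeL d i) := by
  obtain ⟨C₅, h5⟩ := hABE.bound_B
  obtain ⟨C₇, h7⟩ := hABE.increment_four_B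
  obtain ⟨C₈, h8⟩ := hABE.bound_E
  obtain ⟨C₉, h9⟩ := hABE.increment_four_E
  have p5 := (abs_nonneg _).trans (h5 fun _ => 0)
  refine ⟨1 + C₅ + |C₈| + C₇ ^ 4 + C₉ ^ 4, ?_, ?_⟩
  · have := abs_nonneg C₈
    have : 0 ≤ C₇ ^ 4 := by positivity
    have : 0 ≤ C₉ ^ 4 := by positivity
    linarith
  intro Ω _ P _ W hW d T hd t i hi
  have p8 := abs_nonneg C₈
  have p7 : 0 ≤ C₇ ^ 4 := by positivity
  have p9 : 0 ≤ C₉ ^ 4 := by positivity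
  set K := 1 + C₅ + |C₈| + C₇ ^ 4 + C₉ ^ 4 with hK
  have hd' : (0 : ℝ) < d := by exact_mod_cast hd
  set s : ℝ≥0 := (t : ℝ≥0) / T
  constructor
  · have e : ∀ ω, coordL d (i + 1) (sample d T W ω t) = W s (gridPoint ⟨i, hi⟩) ω := fun ω =>
      coord_sample T ω t (i := i + 1) hi
    refine ⟨?_, ?_, ?_, fun j => ?_, fun j => ?_⟩ <;> simp only [e]
    · exact hW.mean _ _
    · exact (hW.hasMoment_four s _).1
    · rw [(hW.hasMoment_four s _).2]
      linarith [(le_abs_self _).trans (h5 ![gridPoint ⟨i, hi⟩, gridPoint ⟨i, hi⟩,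
        gridPoint ⟨i, hi⟩, gridPoint ⟨i, hi⟩])]
    · exact (hW.hasMoment_eight s _ _).1
    · refine (hW.hasMoment_eight s _ _).2.le.trans ((h8 _).trans ?_)
      linarith [le_abs_self C₈]
  · have hi' : i - 1 < d := by omega
    set x := gridPoint ⟨i, hi⟩ with hx
    set y := gridPoint ⟨i - 1, hi'⟩ with hy
    have e : ∀ ω, slopeL d i (sample d T W ω t) = d * (W s x ω - W s y ω) := fun ω => by
      rw [slopeL_apply, coord_sample T ω t (i := i + 1) hi, coord_sample T ω t hi']
      rfl
    -- Equality holds unless `i = 0`, where truncated subtraction makes the two grid points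
    -- coincide.
    have hxy : d * |(x : ℝ) - y| ≤ 1 := by
      rw [← abs_of_pos hd', ← abs_mul, mul_sub, hx, hy]
      simp only [gridPoint]
      rw [mul_div_cancel₀ _ hd'.ne', mul_div_cancel₀ _ hd'.ne']
      rcases Nat.eq_zero_or_pos i with rfl | h
      · simp
      · rw [Nat.cast_sub h]
        simp
    have hxy4 : (d : ℝ) ^ 4 * |(x : ℝ) - y| ^ 4 ≤ 1 := by
      rw [← mul_pow]
      exact pow_le_one₀ (by positivity) hxy
    have bd : ∀ c r : ℝ, 0 ≤ c → r ≤ c * |(x : ℝ) - y| ^ 4 → (d : ℝ) ^ 4 * r ≤ c := by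
      intro c r hc hr
      calc (d : ℝ) ^ 4 * r ≤ (d : ℝ) ^ 4 * (c * |(x : ℝ) - y| ^ 4) := by gcongr
        _ = c * ((d : ℝ) ^ 4 * |(x : ℝ) - y| ^ 4) := by ring
        _ ≤ c * 1 := by gcongr
        _ = c := mul_one c
    have hint : ∀ z, Integrable (W s z) P := fun z => (hW.memLp s z).integrable (by norm_num)
    refine ⟨?_, ?_, ?_, fun j => ?_, fun j => ?_⟩ <;> simp only [e]
    · rw [integral_const_mul, integral_sub (hint x) (hint y), hW.mean, hW.mean]
      simp
    · simp only [mul_pow]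
      exact (hW.hasMoment_four_sub s x y).1.const_mul _
    · simp only [mul_pow, integral_const_mul]
      rw [(hW.hasMoment_four_sub s x y).2]
      refine (bd _ _ p7 ((le_abs_self _).trans (h7 x y))).trans ?_
      linarith
    · simp only [mul_assoc, mul_pow (d : ℝ)]
      exact (hW.hasMoment_eight_sub s x y _).1.const_mul _
    · simp only [mul_assoc, mul_pow (d : ℝ), integral_const_mul]
      refine (mul_le_mul_of_nonneg_left (hW.hasMoment_eight_sub s x y (gridPoint j)).2.le
        (by positivity)).trans ?_
      refine (bd _ _ p9 ((le_abs_self _).trans (h9 x y _ _ _ _))).trans ?_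
      linarith

end Data

/-! ### Independence of the past and the present sample -/

/-- The three variables have a product joint law; reassociating the product moves `Z` to the side of
`X`. -/
theorem indepFun_prodMk_of_indepFun {Ω α β γ : Type*} [MeasurableSpace Ω] [MeasurableSpace α]
    [MeasurableSpace β] [MeasurableSpace γ] {P : Measure Ω} [IsProbabilityMeasure P]
    {X : Ω → α} {Y : Ω → β} {Z : Ω → γ} (hX : Measurable X) (hY : Measurable Y)
    (hZ : Measurable Z) (hXY : IndepFun X Y P) (h : IndepFun (fun ω => (X ω, Y ω)) Z P) :
    IndepFun (fun ω => (Z ω, X ω)) Y P := by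
  have : IsProbabilityMeasure (P.map X) := Measure.isProbabilityMeasure_map hX.aemeasurable
  have : IsProbabilityMeasure (P.map Y) := Measure.isProbabilityMeasure_map hY.aemeasurable
  have : IsProbabilityMeasure (P.map Z) := Measure.isProbabilityMeasure_map hZ.aemeasurable
  have hXZ : IndepFun Z X P := (h.comp measurable_fst measurable_id).symm
  have h1 := (indepFun_iff_map_prod_eq_prod_map_map hZ.aemeasurable
    (hX.prodMk hY).aemeasurable).1 h.symm
  rw [(indepFun_iff_map_prod_eq_prod_map_map hX.aemeasurable hY.aemeasurable).1 hXY,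
    ← Measure.prodAssoc_prod] at h1
  rw [indepFun_iff_map_prod_eq_prod_map_map (hZ.prodMk hX).aemeasurable hY.aemeasurable,
    (indepFun_iff_map_prod_eq_prod_map_map hZ.aemeasurable hX.aemeasurable).1 hXZ]
  have h2 := congrArg (Measure.map MeasurableEquiv.prodAssoc.symm) h1
  rw [Measure.map_map MeasurableEquiv.prodAssoc.symm.measurable (hZ.prodMk (hX.prodMk hY)),
    Measure.map_map MeasurableEquiv.prodAssoc.symm.measurable
      MeasurableEquiv.prodAssoc.measurable] at h2
  rw [MeasurableEquiv.symm_comp_self, Measure.map_id] at h2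
  exact h2

theorem sgd_congr {d : ℕ} {η : ℝ} {x x' : ℕ → Fin d → ℝ} {y y' : ℕ → ℝ} {θ₀ : Fin d → ℝ} {t : ℕ}
    (hx : ∀ s < t, x s = x' s) (hy : ∀ s < t, y s = y' s) :
    sgd η x y θ₀ t = sgd η x' y' θ₀ t := by
  induction t with
  | zero => rfl
  | succ t ih =>
    simp only [sgd]
    rw [ih (fun s hs => hx s (by omega)) (fun s hs => hy s (by omega)), hx t (by omega),
      hy t (by omega)]

/-! ### Moment estimates along the recursion -/

/-- The recursion `Δ^{t+1} = Δ^t + η (ε^t - ⟨ξ^t, Δ^t⟩) ξ^t`, in which `ξ^t` is independent of the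
past of `Δ` and of the current noise. -/
structure IsRecursion {Ω : Type*} [MeasurableSpace Ω] (P : Measure Ω) {d : ℕ} (η : ℝ)
    (ξ : ℕ → Ω → Fin d → ℝ) (ε : ℕ → Ω → ℝ) (Δ : ℕ → Ω → Fin d → ℝ) : Prop where
  measurable_sample : ∀ t, Measurable (ξ t)
  measurable_noise : ∀ t, Measurable (ε t)
  measurable_iterate : ∀ t, Measurable (Δ t)
  step : ∀ t ω, Δ (t + 1) ω = Δ t ω + (η * ε t ω - η * (ξ t ω ⬝ᵥ Δ t ω)) • ξ t ω
  indep : ∀ t, IndepFun (fun ω => ((fun r : Fin (t + 1) => Δ r ω), ε t ω)) (ξ t) P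

/-! ### Young inequalities for the one-step bound -/

theorem sq_mul_sq_le {l : ℝ} (hl : 0 < l) (x y : ℝ) :
    x ^ 2 * y ^ 2 ≤ (x ^ 4 / l + l * y ^ 4) / 2 := by
  have e : (x ^ 4 / l + l * y ^ 4) / 2 - x ^ 2 * y ^ 2 = (x ^ 2 - l * y ^ 2) ^ 2 / (2 * l) := by
    field_simp
    ring
  have : 0 ≤ (x ^ 2 - l * y ^ 2) ^ 2 / (2 * l) := by positivity
  linarith

/-- Here `l` stands for the expected size of `x ^ 2`, with `y` of order one, so both terms of the
bracket have order `l`. The term `x ^ 4 / (2 * m)` is made small by a large `m`. -/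
theorem abs_pow_three_mul_le {l m : ℝ} (hl : 0 < l) (hm : 0 < m) (x y : ℝ) :
    |x| ^ 3 * y ≤ x ^ 4 / (2 * m) + m / 4 * (x ^ 4 / l + l * y ^ 4) := by
  have h1 := sq_mul_sq_le hl x y
  have h2 : |x| ^ 3 * y ≤ x ^ 4 / (2 * m) + m / 2 * (x ^ 2 * y ^ 2) := by
    have e : x ^ 4 / (2 * m) + m / 2 * (x ^ 2 * y ^ 2) - |x| ^ 3 * y
        = |x| ^ 2 * (|x| - m * y) ^ 2 / (2 * m) := by
      rw [← Even.pow_abs (show Even 4 by decide) x, ← sq_abs x]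
      field_simp
      ring
    have : 0 ≤ |x| ^ 2 * (|x| - m * y) ^ 2 / (2 * m) := by positivity
    linarith
  nlinarith

/-- `S` will be of order `1/T` and `n` of order `T^{-1/2}`, so `T * S` and `T ^ 2 * n ^ 4` are of
order one and the increment carries a factor `1/T`. The condition `T⁻¹ ≤ l` absorbs `T * n ^ 4` and
`T * S ^ 4`. -/
theorem stepBound_le {K T l m : ℝ} (hK : 0 ≤ K) (hT : 1 ≤ T) (hl : 0 < l) (hm : 0 < m)
    (hTl : T⁻¹ ≤ l) (y n S : ℝ) :
    stepBound K y n S ≤ y ^ 4 + 24 * K / T * ((1 / (2 * m) + (m / 4 + 1) / l) * y ^ 4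
      + (m / 4 + 3 / 2) * l * (T * S) ^ 4 + 3 / 2 * l * (T ^ 2 * n ^ 4)) := by
  have hT0 : 0 < T := by linarith
  have h1 := abs_pow_three_mul_le hl hm y (T * S)
  have h2 := sq_mul_sq_le hl y (T * S)
  have h3 : T * (y ^ 2 * n ^ 2) ≤ (y ^ 4 / l + l * (T ^ 2 * n ^ 4)) / 2 := by
    have h := sq_mul_sq_le hl y (Real.sqrt T * n)
    have e1 : (Real.sqrt T * n) ^ 2 = T * n ^ 2 := by rw [mul_pow, Real.sq_sqrt hT0.le]
    have e2 : (Real.sqrt T * n) ^ 4 = T ^ 2 * n ^ 4 := by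
      rw [show (Real.sqrt T * n) ^ 4 = ((Real.sqrt T * n) ^ 2) ^ 2 by ring, e1]; ring
    rw [e1, e2] at h
    linarith
  have hTi : 1 ≤ T * l := by
    rw [inv_le_iff_one_le_mul₀' hT0] at hTl
    exact hTl
  have h4 : T * n ^ 4 ≤ l * (T ^ 2 * n ^ 4) := by
    have : 0 ≤ T * n ^ 4 := by positivity
    nlinarith
  have h5 : T * S ^ 4 ≤ l * (T * S) ^ 4 := by
    have h6 : 0 ≤ T * S ^ 4 := by positivity
    have h7 : T * S ^ 4 ≤ T ^ 3 * S ^ 4 := by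
      gcongr
      exact le_self_pow₀ hT (by norm_num)
    have h8 : 0 ≤ T ^ 3 * S ^ 4 := by positivity
    nlinarith
  have h6 : T * (y ^ 2 * S ^ 2) ≤ y ^ 2 * (T * S) ^ 2 := by
    have : T * (y ^ 2 * S ^ 2) ≤ T ^ 2 * (y ^ 2 * S ^ 2) := by
      gcongr
      exact le_self_pow₀ hT (by norm_num)
    linarith
  have h7 : T * (|y| ^ 3 * S + y ^ 2 * n ^ 2 + y ^ 2 * S ^ 2 + n ^ 4 + S ^ 4)
      ≤ (1 / (2 * m) + (m / 4 + 1) / l) * y ^ 4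
      + (m / 4 + 3 / 2) * l * (T * S) ^ 4 + 3 / 2 * l * (T ^ 2 * n ^ 4) := by
    have e : (1 / (2 * m) + (m / 4 + 1) / l) * y ^ 4
        = y ^ 4 / (2 * m) + m / 4 * (y ^ 4 / l) + y ^ 4 / l := by ring
    rw [e]
    linarith
  unfold stepBound
  have h8 := mul_le_mul_of_nonneg_left h7 (show 0 ≤ 24 * K / T by positivity)
  have e : 24 * K / T * (T * (|y| ^ 3 * S + y ^ 2 * n ^ 2 + y ^ 2 * S ^ 2 + n ^ 4 + S ^ 4))
      = 24 * K * (|y| ^ 3 * S + y ^ 2 * n ^ 2 + y ^ 2 * S ^ 2 + n ^ 4 + S ^ 4) := by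
    field_simp
  rw [e] at h8
  linarith

section Recursion

variable {Ω : Type*} [MeasurableSpace Ω] {P : Measure Ω} [IsProbabilityMeasure P] {d : ℕ} {η : ℝ}
  {ξ : ℕ → Ω → Fin d → ℝ} {ε : ℕ → Ω → ℝ} {Δ : ℕ → Ω → Fin d → ℝ}

omit [IsProbabilityMeasure P] in
theorem IsRecursion.apply_succ (h : IsRecursion P η ξ ε Δ) (ℓ : (Fin d → ℝ) →ₗ[ℝ] ℝ) (t : ℕ)
    (ω : Ω) : ℓ (Δ (t + 1) ω)
      = ℓ (Δ t ω) + ℓ (ξ t ω) * (η * ε t ω - ∑ j, η * Δ t ω j * ξ t ω j) := by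
  rw [h.step, map_add, map_smul, smul_eq_mul, mul_comm (ℓ (ξ t ω))]
  congr 3
  unfold dotProduct
  rw [Finset.mul_sum]
  exact Finset.sum_congr rfl fun j _ => by ring

/-- One step of the recursion for the fourth moment of `ℓ (Δ^t) - c ℓ (Δ^s)`, with Young parameters
`l`, `m`. -/
theorem IsRecursion.moment_succ_le (h : IsRecursion P η ξ ε Δ) (hη : 0 ≤ η) {K T C a M : ℝ}
    (hK : 1 ≤ K) (hT : 1 ≤ T) (hηC : η * d * T ≤ C) {ℓ : (Fin d → ℝ) →ₗ[ℝ] ℝ} {t s : ℕ}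
    (hst : s ≤ t) (hℓ : MomentBound P (ξ t) K ℓ) (c : ℝ)
    (hε : Integrable (fun ω => (η * ε t ω) ^ 4) P)
    (hεa : T ^ 2 * ∫ ω, (η * ε t ω) ^ 4 ∂P ≤ a)
    (hM : ∀ j, Integrable (fun ω => Δ t ω j ^ 4) P ∧ ∫ ω, Δ t ω j ^ 4 ∂P ≤ M) (hM0 : 0 ≤ M)
    (hY : Integrable (fun ω => (ℓ (Δ t ω) - c * ℓ (Δ s ω)) ^ 4) P)
    {l m : ℝ} (hl : 0 < l) (hm : 0 < m) (hTl : T⁻¹ ≤ l) :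
    Integrable (fun ω => (ℓ (Δ (t + 1) ω) - c * ℓ (Δ s ω)) ^ 4) P ∧
    ∫ ω, (ℓ (Δ (t + 1) ω) - c * ℓ (Δ s ω)) ^ 4 ∂P
      ≤ ∫ ω, (ℓ (Δ t ω) - c * ℓ (Δ s ω)) ^ 4 ∂P
        + 24 * K / T * ((1 / (2 * m) + (m / 4 + 1) / l)
            * ∫ ω, (ℓ (Δ t ω) - c * ℓ (Δ s ω)) ^ 4 ∂P
          + (m / 4 + 3 / 2) * l * (C ^ 4 * M) + 3 / 2 * l * a) := by
  have hT0 : 0 < T := by linarith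
  have hℓm : Measurable ℓ := ℓ.continuous_of_finiteDimensional.measurable
  have hC0 : 0 ≤ η * d * T := by positivity
  -- By Hölder, `p` dominates the fourth power of `T` times the `ℓ¹` norm of the drift weights: `η *
  -- d * T ≤ C` turns that norm into an average over coordinates.
  let p : Ω → ℝ := fun ω => C ^ 4 * ((d : ℝ)⁻¹ * ∑ j, Δ t ω j ^ 4)
  have hp : Integrable p P :=
    ((integrable_finsetSum _ fun j _ => (hM j).1).const_mul _).const_mul _
  have hpM : ∫ ω, p ω ∂P ≤ C ^ 4 * M := by
    simp only [p, integral_const_mul]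
    have hC4 : 0 ≤ C ^ 4 := by positivity
    gcongr
    rw [integral_finsetSum _ fun j _ => (hM j).1]
    rcases Nat.eq_zero_or_pos d with hd | hd
    · subst hd; simpa using hM0
    · have hd' : (0 : ℝ) < d := by exact_mod_cast hd
      rw [inv_mul_le_iff₀ hd']
      refine (Finset.sum_le_sum fun j _ => (hM j).2).trans (le_of_eq ?_)
      simp
  have hpS : ∀ ω, (T * ∑ j, |η * Δ t ω j|) ^ 4 ≤ p ω := by
    intro ω
    have h1 := pow_sum_le_card_mul_sum_pow (s := (Finset.univ : Finset (Fin d)))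
      (f := fun j => |Δ t ω j|) (fun _ _ => abs_nonneg _) 3
    simp only [Finset.card_univ, Fintype.card_fin, Nat.reduceAdd,
      Even.pow_abs (show Even 4 by decide)] at h1
    simp only [abs_mul, abs_of_nonneg hη, ← Finset.mul_sum]
    calc (T * (η * ∑ j, |Δ t ω j|)) ^ 4 = (η * T) ^ 4 * (∑ j, |Δ t ω j|) ^ 4 := by ring
      _ ≤ (η * T) ^ 4 * ((d : ℝ) ^ 3 * ∑ j, Δ t ω j ^ 4) := by gcongr
      _ = (η * d * T) ^ 4 * ((d : ℝ)⁻¹ * ∑ j, Δ t ω j ^ 4) := by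
          rcases Nat.eq_zero_or_pos d with hd | hd
          · subst hd; simp
          · have hd' : (d : ℝ) ≠ 0 := by positivity
            field_simp
      _ ≤ p ω := by
          have : 0 ≤ (d : ℝ)⁻¹ * ∑ j, Δ t ω j ^ 4 :=
            mul_nonneg (by positivity) (Finset.sum_nonneg fun j _ => by positivity)
          simp only [p]
          gcongr
  let g : Ω → ℝ := fun ω => (ℓ (Δ t ω) - c * ℓ (Δ s ω)) ^ 4 + 24 * K / T *
    ((1 / (2 * m) + (m / 4 + 1) / l) * (ℓ (Δ t ω) - c * ℓ (Δ s ω)) ^ 4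
      + (m / 4 + 3 / 2) * l * p ω + 3 / 2 * l * (T ^ 2 * (η * ε t ω) ^ 4))
  have i1 := hY.const_mul (1 / (2 * m) + (m / 4 + 1) / l)
  have i2 := hp.const_mul ((m / 4 + 3 / 2) * l)
  have i3 := (hε.const_mul (T ^ 2)).const_mul (3 / 2 * l)
  have i12 : Integrable (fun ω => (1 / (2 * m) + (m / 4 + 1) / l)
      * (ℓ (Δ t ω) - c * ℓ (Δ s ω)) ^ 4 + (m / 4 + 3 / 2) * l * p ω) P := i1.add i2
  have i123 : Integrable (fun ω => (1 / (2 * m) + (m / 4 + 1) / l)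
      * (ℓ (Δ t ω) - c * ℓ (Δ s ω)) ^ 4 + (m / 4 + 3 / 2) * l * p ω
      + 3 / 2 * l * (T ^ 2 * (η * ε t ω) ^ 4)) P := i12.add i3
  have hg : Integrable g P := hY.add (i123.const_mul (24 * K / T))
  let Z := (Fin (t + 1) → Fin d → ℝ) × ℝ
  have key := integral_step_le (P := P) (Z := Z)
    (ζ := fun ω => ((fun r : Fin (t + 1) => Δ r ω), ε t ω))
    (Measurable.prodMk (measurable_pi_lambda _ fun r => h.measurable_iterate (r : ℕ))
      (h.measurable_noise t))
    (h.measurable_sample t) (h.indep t) hK hℓ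
    (y := fun z => ℓ (z.1 (Fin.last t)) - c * ℓ (z.1 ⟨s, by omega⟩))
    (n := fun z => η * z.2) (w := fun z => fun j => η * z.1 (Fin.last t) j)
    (by
      refine Measurable.sub ?_ (Measurable.const_mul ?_ c)
      · exact hℓm.comp ((measurable_pi_apply _).comp measurable_fst)
      · exact hℓm.comp ((measurable_pi_apply _).comp measurable_fst))
    (measurable_snd.const_mul η)
    (((measurable_pi_apply (Fin.last t)).comp measurable_fst).const_smul η)
    hg (fun ω => by
      refine (stepBound_le (by linarith) hT hl hm hTl _ _ _).trans ?_
      simp only [g, Fin.val_last]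
      gcongr
      exact hpS ω)
  simp only [Fin.val_last] at key
  have e : ∀ ω, ℓ (Δ (t + 1) ω) - c * ℓ (Δ s ω) = ℓ (Δ t ω) - c * ℓ (Δ s ω)
      + ℓ (ξ t ω) * (η * ε t ω - ∑ j, η * Δ t ω j * ξ t ω j) := by
    intro ω
    rw [h.apply_succ]
    ring
  simp only [← e] at key
  refine ⟨key.1, key.2.trans ?_⟩
  have hgi : ∫ ω, g ω ∂P = ∫ ω, (ℓ (Δ t ω) - c * ℓ (Δ s ω)) ^ 4 ∂P
        + 24 * K / T * ((1 / (2 * m) + (m / 4 + 1) / l)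
            * ∫ ω, (ℓ (Δ t ω) - c * ℓ (Δ s ω)) ^ 4 ∂P
          + (m / 4 + 3 / 2) * l * ∫ ω, p ω ∂P
          + 3 / 2 * l * (T ^ 2 * ∫ ω, (η * ε t ω) ^ 4 ∂P)) := by
    simp only [g]
    rw [integral_add hY (i123.const_mul (24 * K / T)), integral_const_mul, integral_add i12 i3, integral_add i1 i2]
    simp only [integral_const_mul]
  rw [hgi]
  have hK0 : 0 ≤ 24 * K / T := by positivity
  gcongr

/-- Uniform bound for the fourth moments of the coordinates. -/
theorem IsRecursion.moment_coord_le (h : IsRecursion P η ξ ε Δ) (hη : 0 ≤ η) {K T C a R : ℝ}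
    (hK : 1 ≤ K) (hT : 1 ≤ T) (hηC : η * d * T ≤ C) (ha : 0 ≤ a)
    (hℓ : ∀ t j, MomentBound P (ξ t) K (LinearMap.proj j))
    (hε : ∀ t, Integrable (fun ω => (η * ε t ω) ^ 4) P ∧ T ^ 2 * ∫ ω, (η * ε t ω) ^ 4 ∂P ≤ a)
    (h0 : ∀ j, Integrable (fun ω => Δ 0 ω j ^ 4) P ∧ ∫ ω, Δ 0 ω j ^ 4 ∂P ≤ R) (hR : 0 ≤ R) (t : ℕ)
    (j : Fin d) :
    Integrable (fun ω => Δ t ω j ^ 4) P ∧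
    ∫ ω, Δ t ω j ^ 4 ∂P ≤ Real.exp (48 * K * (1 + C ^ 4 + a) * (t / T)) * (R + 1) := by
  have hT0 : 0 < T := by linarith
  set b := 48 * K * (1 + C ^ 4 + a) with hb
  have hb0 : 0 ≤ b := by positivity
  -- All coordinates are treated together since the drift of one involves the others. Shifting by
  -- `1` turns the affine recursion into a linear one for `M + 1`.
  have hmain : ∀ t : ℕ, ∀ j, Integrable (fun ω => Δ t ω j ^ 4) P ∧
      ∫ ω, Δ t ω j ^ 4 ∂P ≤ (1 + b / T) ^ t * (R + 1) - 1 := by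
    intro t
    induction t with
    | zero => intro j; refine ⟨(h0 j).1, (h0 j).2.trans (by simp)⟩
    | succ t ih =>
      intro j
      set M := (1 + b / T) ^ t * (R + 1) - 1 with hM
      have hM0 : 0 ≤ M := by
        have h1 : 1 ≤ (1 + b / T) ^ t := one_le_pow₀ (le_add_of_nonneg_right (by positivity))
        nlinarith
      have key := h.moment_succ_le hη hK hT hηC le_rfl (hℓ t j) 0 (hε t).1 (hε t).2 ih hM0
        (by simpa using (ih j).1) one_pos one_pos (inv_le_one_of_one_le₀ hT)
      simp only [LinearMap.proj_apply, zero_mul, sub_zero] at key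
      refine ⟨key.1, key.2.trans ?_⟩
      set y := ∫ ω, Δ t ω j ^ 4 ∂P
      have hy : y ≤ M := (ih j).2
      have hC4 : 0 ≤ C ^ 4 * M := by positivity
      have h1 : (1 / (2 * 1) + (1 / 4 + 1) / 1) * y + (1 / 4 + 3 / 2) * 1 * (C ^ 4 * M)
          + 3 / 2 * 1 * a ≤ 2 * (1 + C ^ 4 + a) * (M + 1) := by
        have : 0 ≤ a * M := by positivity
        have : 0 ≤ C ^ 4 := by positivity
        nlinarith
      have h2 : (1 + b / T) ^ (t + 1) * (R + 1) - 1 = M + b / T * (M + 1) := by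
        rw [hM, pow_succ]; ring
      rw [h2]
      have h3 : 24 * K / T * (2 * (1 + C ^ 4 + a) * (M + 1)) = b / T * (M + 1) := by
        rw [hb]; ring
      rw [← h3]
      gcongr
  refine ⟨(hmain t j).1, (hmain t j).2.trans ?_⟩
  have h1 : (1 + b / T) ^ t ≤ Real.exp (b * (t / T)) := by
    have h2 : 1 + b / T ≤ Real.exp (b / T) := by
      rw [add_comm]; exact Real.add_one_le_exp _
    calc (1 + b / T) ^ t ≤ Real.exp (b / T) ^ t := by gcongr
      _ = Real.exp (b * (t / T)) := by rw [← Real.exp_nat_mul]; congr 1; ring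
  have : (1 + b / T) ^ t * (R + 1) ≤ Real.exp (b * (t / T)) * (R + 1) := by gcongr
  linarith

/-- Fourth moments of the time increments of a functional. -/
theorem IsRecursion.moment_increment_le (h : IsRecursion P η ξ ε Δ) (hη : 0 ≤ η)
    {K T C a M κ c : ℝ} (hK : 1 ≤ K) (hT : 1 ≤ T) (hηC : η * d * T ≤ C) (ha : 0 ≤ a)
    (hM0 : 0 ≤ M) (hκ : 0 ≤ κ)
    (hc : 48 * K * ((24 * K * (κ + 1) / 4 + 3 / 2) * (C ^ 4 * M) + 3 / 2 * a
      + (24 * K * (κ + 1) / 4 + 1)) ≤ c)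
    {N : ℕ} (hN : N ≤ κ * T) {ℓ : (Fin d → ℝ) →ₗ[ℝ] ℝ} (hℓ : ∀ t, MomentBound P (ξ t) K ℓ)
    (hε : ∀ t, Integrable (fun ω => (η * ε t ω) ^ 4) P ∧ T ^ 2 * ∫ ω, (η * ε t ω) ^ 4 ∂P ≤ a)
    (hM : ∀ t ≤ N, ∀ j, Integrable (fun ω => Δ t ω j ^ 4) P ∧ ∫ ω, Δ t ω j ^ 4 ∂P ≤ M)
    {s t : ℕ} (hst : s ≤ t) (htN : t ≤ N) :
    Integrable (fun ω => (ℓ (Δ t ω) - ℓ (Δ s ω)) ^ 4) P ∧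
    ∫ ω, (ℓ (Δ t ω) - ℓ (Δ s ω)) ^ 4 ∂P ≤ (c * (((t : ℝ) - s) / T)) ^ 2 := by
  have hT0 : 0 < T := by linarith
  -- With this `m` and `l ≤ c * (κ + 1)` below, the term with `1 / (2 * m)` uses exactly half of
  -- `c`; `hc` fits the rest into the other half.
  set m := 24 * K * (κ + 1) with hm
  have hm0 : 0 < m := by positivity
  have hCM : 0 ≤ C ^ 4 * M := by positivity
  have hc1 : 1 ≤ c := by
    refine le_trans ?_ hc
    have : 0 ≤ (m / 4 + 3 / 2) * (C ^ 4 * M) + 3 / 2 * a + m / 4 := by positivity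
    nlinarith
  induction t, hst using Nat.le_induction with
  | base => simp
  | succ t hst ih =>
    obtain ⟨ih1, ih2⟩ := ih (by omega)
    have hst' : (0 : ℝ) ≤ (t : ℝ) - s := sub_nonneg.2 (by exact_mod_cast hst)
    push_cast
    have e : ((t : ℝ) + 1 - s) / T = ((t : ℝ) - s) / T + 1 / T := by ring
    rw [e]
    set δ := ((t : ℝ) - s) / T with hδ
    have hδ0 : 0 ≤ δ := by positivity
    have hδκ : δ + 1 / T ≤ κ + 1 := by
      rw [hδ, ← add_div, div_le_iff₀ hT0]
      have : (t : ℝ) + 1 ≤ N := by exact_mod_cast htN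
      have : (0 : ℝ) ≤ s := Nat.cast_nonneg s
      nlinarith
    -- The target at time `t + 1` is `l ^ 2`. The induction hypothesis `(l - c / T) ^ 2` is at most
    -- `l ^ 2 - l * (c / T)`, so one step may cost `l * (c / T)`.
    set l := c * (δ + 1 / T) with hl
    have hTi : 0 < 1 / T := by positivity
    have hlT : c / T ≤ l := by
      rw [hl, mul_add, mul_one_div]
      exact le_add_of_nonneg_left (by positivity)
    have hl0 : 0 < l := by positivity
    have key := h.moment_succ_le hη hK hT hηC hst (hℓ t) 1 (hε t).1 (hε t).2 (hM t (by omega)) hM0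
      (by simpa using ih1) hl0 hm0 (by
        refine le_trans ?_ hlT
        rw [inv_eq_one_div]
        gcongr)
    simp only [one_mul] at key
    refine ⟨key.1, key.2.trans ?_⟩
    set y := ∫ ω, (ℓ (Δ t ω) - ℓ (Δ s ω)) ^ 4 ∂P
    have hy0 : 0 ≤ y := integral_nonneg fun ω => by positivity
    have hδl : c * δ = l - c / T := by rw [hl]; ring
    have hyl : y ≤ l ^ 2 - l * (c / T) := by
      refine ih2.trans ?_
      rw [hδl]
      have : 0 ≤ c / T := by positivity
      nlinarith
    have hyl2 : y ≤ l ^ 2 := by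
      have : 0 ≤ l * (c / T) := by positivity
      linarith
    have h1 : (1 / (2 * m) + (m / 4 + 1) / l) * y
        ≤ l * (c * (κ + 1) / (2 * m) + (m / 4 + 1)) := by
      calc (1 / (2 * m) + (m / 4 + 1) / l) * y ≤ (1 / (2 * m) + (m / 4 + 1) / l) * l ^ 2 := by
            gcongr
        _ = l * (l / (2 * m) + (m / 4 + 1)) := by field_simp
        _ ≤ l * (c * (κ + 1) / (2 * m) + (m / 4 + 1)) := by
            gcongr
            exact mul_le_mul_of_nonneg_left hδκ (by linarith)
    have h2 : 24 * K * (c * (κ + 1) / (2 * m)) = c / 2 := by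
      rw [hm]; field_simp
    have h3 : 24 * K * (l * (c * (κ + 1) / (2 * m) + (m / 4 + 1))
        + (m / 4 + 3 / 2) * l * (C ^ 4 * M) + 3 / 2 * l * a) ≤ l * c := by
      have e1 : 24 * K * (l * (c * (κ + 1) / (2 * m) + (m / 4 + 1))
          + (m / 4 + 3 / 2) * l * (C ^ 4 * M) + 3 / 2 * l * a)
          = l * (24 * K * (c * (κ + 1) / (2 * m)) + 24 * K * ((m / 4 + 3 / 2) * (C ^ 4 * M)
            + 3 / 2 * a + (m / 4 + 1))) := by ring
      rw [e1, h2]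
      gcongr
      linarith
    have h4 : 24 * K / T * ((1 / (2 * m) + (m / 4 + 1) / l) * y
        + (m / 4 + 3 / 2) * l * (C ^ 4 * M) + 3 / 2 * l * a) ≤ l * (c / T) := by
      rw [div_mul_eq_mul_div, mul_div_assoc' l, div_le_div_iff_of_pos_right hT0]
      refine le_trans ?_ h3
      gcongr
    linarith

end Recursion

/-! ### The centred iterates satisfy the recursion -/

theorem centeredIterate_succ {Ω : Type*} (d T : ℕ) (η : ℝ) (W : ℝ≥0 → I → Ω → ℝ) (ε : ℕ → Ω → ℝ)
    (θstar : Fin d → ℝ) (θ₀ : Ω → Fin d → ℝ) (ω : Ω) (t : ℕ) :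
    centeredIterate d T η W ε θstar θ₀ ω (t + 1) = centeredIterate d T η W ε θstar θ₀ ω t
      + (η * ε t ω - η * (sample d T W ω t ⬝ᵥ centeredIterate d T η W ε θstar θ₀ ω t))
        • sample d T W ω t := by
  simp only [centeredIterate, sgd, dotProduct_sub]
  module

/-- Whiteness separates the current slice from the earlier ones, the times `t / T` being distinct;
independence of `ζ` from the whole of `W` lets `ζ` join the past. -/
theorem indepFun_past_sample {Ω : Type*} [MeasurableSpace Ω] {P : Measure Ω}
    [IsProbabilityMeasure P] {W : ℝ≥0 → I → Ω → ℝ} {A : I → I → ℝ} {B : (Fin 4 → I) → ℝ}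
    {E : (Fin 8 → I) → ℝ} (hW : IsDataProcess P W A B E) {d T : ℕ} (hT : 0 < T) {Z : Type*}
    [MeasurableSpace Z] {ζ : Ω → Z} (hζ : Measurable ζ)
    (hind : IndepFun (fun (ω : Ω) (p : ℝ≥0 × I) => W p.1 p.2 ω) ζ P) (t : ℕ) :
    IndepFun (fun ω => (ζ ω, fun r : Finset.range t => sample d T W ω r))
      (fun ω => sample d T W ω t) P := by
  have hm := measurable_sample d T hW.measurable
  have hinj : Function.Injective fun t : ℕ => (t : ℝ≥0) / T := by
    intro a b hab
    have hT' : (T : ℝ≥0) ≠ 0 := by exact_mod_cast hT.ne'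
    simpa [div_left_inj' hT'] using hab
  have h1 : iIndepFun (fun (t : ℕ) (ω : Ω) => sample d T W ω t) P := by
    have := (hW.white.precomp hinj).comp (fun _ (f : I → ℝ) (k : Fin d) => f (gridPoint k))
      fun _ => measurable_pi_lambda _ fun k => measurable_pi_apply _
    exact this
  have h2 := h1.indepFun_finset (Finset.range t) {t} (by simp) hm
  have h3 : IndepFun (fun ω (r : Finset.range t) => sample d T W ω r)
      (fun ω => sample d T W ω t) P :=
    h2.comp measurable_id
      (measurable_pi_apply (⟨t, Finset.mem_singleton_self t⟩ : ({t} : Finset ℕ)))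
  refine indepFun_prodMk_of_indepFun (measurable_pi_lambda _ fun r => hm r) (hm t) hζ h3 ?_
  refine hind.comp (φ := fun f => ((fun (r : Finset.range t) (k : Fin d) =>
    f ((((r : ℕ) : ℝ≥0) / T), gridPoint k)), fun k : Fin d => f ((t : ℝ≥0) / T, gridPoint k)))
    ?_ measurable_id
  refine Measurable.prodMk ?_ ?_
  · exact measurable_pi_lambda _ fun r => measurable_pi_lambda _ fun k => measurable_pi_apply _
  · exact measurable_pi_lambda _ fun k => measurable_pi_apply _

theorem isRecursion_centeredIterate {Ω : Type*} [MeasurableSpace Ω] {P : Measure Ω}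
    [IsProbabilityMeasure P] {W : ℝ≥0 → I → Ω → ℝ} {A : I → I → ℝ} {B : (Fin 4 → I) → ℝ}
    {E : (Fin 8 → I) → ℝ} (hW : IsDataProcess P W A B E) {d T : ℕ} (hT : 0 < T) (η : ℝ)
    {ε : ℕ → Ω → ℝ} (hε : ∀ t, Measurable (ε t)) (θstar : Fin d → ℝ) {θ₀ : Ω → Fin d → ℝ}
    (hθ : Measurable θ₀)
    (hind : IndepFun (fun (ω : Ω) (p : ℝ≥0 × I) => W p.1 p.2 ω)
      (fun ω => (θ₀ ω, fun t : ℕ => ε t ω)) P) :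
    IsRecursion P η (fun t ω => sample d T W ω t) ε
      (fun t ω => centeredIterate d T η W ε θstar θ₀ ω t) where
  measurable_sample := measurable_sample d T hW.measurable
  measurable_noise := hε
  measurable_iterate := measurable_centeredIterate d T η hW.measurable hε hθ
  step t ω := centeredIterate_succ d T η W ε θstar θ₀ ω t
  indep t := by
    have h := indepFun_past_sample (d := d) hW hT
      (hθ.prodMk (measurable_pi_lambda _ fun t => hε t)) hind t
    -- The iterates up to time `t` are rebuilt as a measurable function of the initial guess, the
    -- noise and the samples before `t`. By causality, setting the remaining samples to `0` changes
    -- nothing.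
    let Z := ((Fin d → ℝ) × (ℕ → ℝ)) × (Finset.range t → Fin d → ℝ)
    let x : Z → ℕ → Fin d → ℝ := fun z s => if hs : s ∈ Finset.range t then z.2 ⟨s, hs⟩ else 0
    let y : Z → ℕ → ℝ := fun z s => x z s ⬝ᵥ θstar + z.1.2 s
    have hx : ∀ s, Measurable fun z => x z s := by
      intro s
      by_cases hs : s ∈ Finset.range t
      · simp only [x, hs, dif_pos]
        exact (measurable_pi_apply _).comp measurable_snd
      · simp only [x, hs, dif_neg, not_false_iff]
        exact measurable_const
    have hy : ∀ s, Measurable fun z => y z s := by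
      intro s
      refine Measurable.add ?_ ((measurable_pi_apply s).comp (measurable_snd.comp measurable_fst))
      unfold dotProduct
      exact Finset.measurable_sum _ fun i _ => ((measurable_pi_apply i).comp (hx s)).mul_const _
    have hΦ : Measurable fun z : Z => ((fun r : Fin (t + 1) =>
        sgd η (x z) (y z) z.1.1 r - θstar), z.1.2 t) := by
      refine Measurable.prodMk (measurable_pi_lambda _ fun r => ?_)
        ((measurable_pi_apply t).comp (measurable_snd.comp measurable_fst))
      exact (measurable_sgd η hx hy (measurable_fst.comp measurable_fst) r).sub_const θstar
    have h2 := h.comp hΦ measurable_id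
    have e : ∀ ω, ((fun r : Fin (t + 1) => centeredIterate d T η W ε θstar θ₀ ω r), ε t ω)
        = (fun z : Z => ((fun r : Fin (t + 1) => sgd η (x z) (y z) z.1.1 r - θstar), z.1.2 t))
          ((θ₀ ω, fun t => ε t ω), fun r => sample d T W ω r) := by
      intro ω
      refine Prod.ext (funext fun r => ?_) rfl
      have hxs : ∀ s < (r : ℕ), sample d T W ω s
          = x ((θ₀ ω, fun t => ε t ω), fun r => sample d T W ω r) s := by
        intro s hs
        have : s ∈ Finset.range t := Finset.mem_range.2 (by omega)
        simp only [x, this, dif_pos]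
      exact congrArg (· - θstar) (sgd_congr hxs fun s hs =>
        congrArg (fun v => v ⬝ᵥ θstar + ε s ω) (hxs s hs))
    simp only [e]
    exact h2

/-! ### Uniform moment estimates for the online SGD iterates -/

/-- The functionals that make up the energy: index `0` is the first coordinate, index `k + 1` the
difference quotient at `k`. -/
noncomputable def feature (d : ℕ) : ℕ → (Fin d → ℝ) →ₗ[ℝ] ℝ
  | 0 => coordL d 1
  | k + 1 => slopeL d k

theorem energy_eq_feature {d : ℕ} (v : Fin d → ℝ) :
    energy v = feature d 0 v ^ 4
      + (d : ℝ)⁻¹ * ∑ k ∈ Finset.range d, feature d (k + 1) v ^ 4 := by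
  simp only [energy, feature, coordL_apply, slopeL_apply, Even.pow_abs (show Even 4 by decide)]
  -- The indices `0` and `1` name the same coordinate, definitionally.
  rfl

/-- The constants are fixed in the order `K` (samples), `a` (noise), `M` (coordinates up to the
horizon `κ`), `c₀` (increments), before `d`, `T` and the feature appear. -/
theorem exists_moment_estimates {A : I → I → ℝ} {B : (Fin 4 → I) → ℝ} {E : (Fin 8 → I) → ℝ}
    (hABE : SmoothMoments A B E) (κ C₁ R L C : ℝ) (hκ : 0 ≤ κ) (hC₁ : 0 ≤ C₁) :
    ∃ c : ℝ, 0 ≤ c ∧ ∀ (d T : ℕ), 0 < d → 0 < T → ∀ (η σ : ℝ), 0 < η → 0 ≤ σ → η * d * T ≤ C →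
      η * σ * Real.sqrt T ≤ C → ∀ {Ω : Type*} [MeasurableSpace Ω] (P : Measure Ω)
      [IsProbabilityMeasure P] (W : ℝ≥0 → I → Ω → ℝ) (ε : ℕ → Ω → ℝ) (θstar : Fin d → ℝ)
      (θ₀ : Ω → Fin d → ℝ), IsDataProcess P W A B E → IsNoise P ε σ C₁ →
      IsInitialCondition P (fun ω => θ₀ ω - θstar) R L →
      IndepFun (fun (ω : Ω) (p : ℝ≥0 × I) => W p.1 p.2 ω) (fun ω => (θ₀ ω, fun t : ℕ => ε t ω)) P →
      ∀ N : ℕ, N ≤ κ * T → ∀ i ≤ d,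
        (Integrable (fun ω => feature d i (centeredIterate d T η W ε θstar θ₀ ω 0) ^ 4) P ∧
          ∫ ω, feature d i (centeredIterate d T η W ε θstar θ₀ ω 0) ^ 4 ∂P ≤ c) ∧
        ∀ s t, s ≤ t → t ≤ N →
          Integrable (fun ω => (feature d i (centeredIterate d T η W ε θstar θ₀ ω t)
            - feature d i (centeredIterate d T η W ε θstar θ₀ ω s)) ^ 4) P ∧
          ∫ ω, (feature d i (centeredIterate d T η W ε θstar θ₀ ω t)
            - feature d i (centeredIterate d T η W ε θstar θ₀ ω s)) ^ 4 ∂P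
            ≤ c * (((t : ℝ) - s) / T) ^ 2 := by
  obtain ⟨K, hK1, hK⟩ := exists_momentBound hABE
  set a := C₁ * C ^ 4 with ha
  have ha0 : 0 ≤ a := by positivity
  set M := Real.exp (48 * K * (1 + C ^ 4 + a) * κ) * (R ^ 4 + 1) with hM
  have hM0 : 0 ≤ M := by positivity
  set c₀ := 48 * K * ((24 * K * (κ + 1) / 4 + 3 / 2) * (C ^ 4 * M) + 3 / 2 * a
      + (24 * K * (κ + 1) / 4 + 1)) with hc₀
  refine ⟨R ^ 4 + L ^ 4 + c₀ ^ 2, by positivity, ?_⟩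
  intro d T hd hT η σ hη hσ hηC hησ Ω _ P _ W ε θstar θ₀ hW hε hinit hind N hN i hi
  have hd' : (0 : ℝ) < d := by exact_mod_cast hd
  have hT' : (1 : ℝ) ≤ T := by exact_mod_cast hT
  have hT0 : (0 : ℝ) < T := by linarith
  have hev : ∀ z : ℝ, |z| ^ 4 = z ^ 4 := Even.pow_abs (show Even 4 by decide)
  have hθ : Measurable θ₀ := by
    simpa using hinit.measurable.add_const θstar
  have hrec := isRecursion_centeredIterate hW hT η hε.measurable θstar hθ hind
  have hΔ0 : ∀ ω, centeredIterate d T η W ε θstar θ₀ ω 0 = θ₀ ω - θstar := fun ω => rfl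
  have hcoordL : ∀ j : Fin d, coordL d (j + 1) = LinearMap.proj j := by
    intro j
    refine LinearMap.ext fun v => ?_
    simp [coordL_apply, coord]
  have hcoord : ∀ t, ∀ j : Fin d, MomentBound P (fun ω => sample d T W ω t) K
      (LinearMap.proj j) := by
    intro t j
    rw [← hcoordL]
    exact (hK P W hW d T hd t j j.2).1
  have hnoise : ∀ t, Integrable (fun ω => (η * ε t ω) ^ 4) P ∧
      (T : ℝ) ^ 2 * ∫ ω, (η * ε t ω) ^ 4 ∂P ≤ a := by
    intro t
    have i4 : Integrable (fun ω => ε t ω ^ 4) P := by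
      have := (hε.memLp t).integrable_norm_pow (p := 4) (by norm_num)
      simpa only [Real.norm_eq_abs, hev] using this
    simp only [mul_pow, integral_const_mul]
    refine ⟨i4.const_mul _, ?_⟩
    have h4 := hε.moment_four t
    simp only [hev] at h4
    calc (T : ℝ) ^ 2 * (η ^ 4 * ∫ ω, ε t ω ^ 4 ∂P) ≤ (T : ℝ) ^ 2 * (η ^ 4 * (C₁ * σ ^ 4)) := by
          gcongr
      _ = C₁ * ((η * σ * Real.sqrt T) ^ 4) := by
          have : Real.sqrt T ^ 4 = (T : ℝ) ^ 2 := by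
            rw [show Real.sqrt T ^ 4 = (Real.sqrt T ^ 2) ^ 2 by ring, Real.sq_sqrt hT0.le]
          rw [mul_pow, this]
          ring
      _ ≤ a := by rw [ha]; gcongr
  have hint : ∀ k, Integrable (fun ω => coord (θ₀ ω - θstar) k ^ 4) P := by
    intro k
    unfold coord
    split_ifs with h
    · have := (hinit.memLp ⟨k - 1, h⟩).integrable_norm_pow (p := 4) (by norm_num)
      simpa only [Real.norm_eq_abs, hev] using this
    · simp
  have hmeas : ∀ k, Measurable fun ω => coord (θ₀ ω - θstar) k := fun k =>
    (continuous_coord k).measurable.comp hinit.measurable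
  have hR : ∀ k ≤ d, ∫ ω, coord (θ₀ ω - θstar) k ^ 4 ∂P ≤ R ^ 4 := by
    intro k hk
    simpa only [hev] using hinit.moment k hk
  have hMt : ∀ t ≤ N, ∀ j, Integrable (fun ω => centeredIterate d T η W ε θstar θ₀ ω t j ^ 4) P ∧
      ∫ ω, centeredIterate d T η W ε θstar θ₀ ω t j ^ 4 ∂P ≤ M := by
    intro t ht j
    have h := hrec.moment_coord_le (R := R ^ 4) hη.le hK1 hT' hηC ha0 hcoord hnoise
      (fun j => by
        have e : ∀ ω, centeredIterate d T η W ε θstar θ₀ ω 0 j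
            = coord (θ₀ ω - θstar) (j + 1) := fun ω => by simp [coord, hΔ0]
        simp only [e]
        exact ⟨hint _, hR _ j.2⟩) (by positivity) t j
    refine ⟨h.1, h.2.trans ?_⟩
    rw [hM]
    gcongr
    rw [div_le_iff₀ hT0]
    exact le_trans (by exact_mod_cast ht) hN
  have hfeat : ∀ t, MomentBound P (fun ω => sample d T W ω t) K (feature d i) := by
    intro t
    rcases i with _ | k
    · exact (hK P W hW d T hd t 0 hd).1
    · exact (hK P W hW d T hd t k (by omega)).2
  constructor
  · simp only [hΔ0]
    have hc2 : 0 ≤ c₀ ^ 2 := by positivity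
    have hL4 : 0 ≤ L ^ 4 := by positivity
    have hR4 : 0 ≤ R ^ 4 := by positivity
    rcases i with _ | k
    · simp only [feature, coordL_apply]
      exact ⟨hint 1, (hR 1 hd).trans (by linarith)⟩
    · simp only [feature, slopeL_apply, mul_pow, integral_const_mul]
      have h1 := hinit.increment (k + 1) (by omega) hi
      simp only [hev, Nat.add_sub_cancel] at h1
      constructor
      · refine Integrable.const_mul ?_ _
        refine (((hint (k + 1)).add (hint k)).const_mul 8).mono'
          (((hmeas (k + 1)).sub (hmeas k)).pow_const 4).aestronglyMeasurable
          (ae_of_all _ fun ω => ?_)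
        rw [Real.norm_of_nonneg (by positivity)]
        have := add_pow_four_le (coord (θ₀ ω - θstar) (k + 1)) (-coord (θ₀ ω - θstar) k)
        simpa only [Pi.add_apply, hev, ← sub_eq_add_neg, Even.neg_pow (show Even 4 by decide)] using this
      · calc (d : ℝ) ^ 4 * ∫ ω, (coord (θ₀ ω - θstar) (k + 1) - coord (θ₀ ω - θstar) k) ^ 4 ∂P
            ≤ (d : ℝ) ^ 4 * (L ^ 4 * (d : ℝ)⁻¹ ^ 4) := by gcongr
          _ = L ^ 4 := by field_simp
          _ ≤ _ := by linarith
  · intro s t hst htN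
    have h := hrec.moment_increment_le (c := c₀) hη.le hK1 hT' hηC ha0 hM0 hκ le_rfl hN hfeat hnoise hMt
      hst htN
    refine ⟨h.1, h.2.trans ?_⟩
    rw [mul_pow]
    gcongr
    have hL4 : 0 ≤ L ^ 4 := by positivity
    have hR4 : 0 ≤ R ^ 4 := by positivity
    linarith

/-! ### Dyadic chaining -/

/-- Follow the binary digits of `r`: a digit `1` at place `l` costs one dyadic increment of level
`l`. -/
theorem abs_sub_block_le {f : ℕ → ℝ} {N : ℕ} {H b : ℝ} (hH : 0 ≤ H) (hb : 0 ≤ b)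
    (hf : ∀ n k, (k + 1) * 2 ^ n ≤ N → |f ((k + 1) * 2 ^ n) - f (k * 2 ^ n)| ≤ H * b ^ n) (n : ℕ) :
    ∀ k r, r < 2 ^ n → k * 2 ^ n + r ≤ N →
      |f (k * 2 ^ n + r) - f (k * 2 ^ n)| ≤ H * ∑ l ∈ Finset.range n, b ^ l := by
  induction n with
  | zero =>
    intro k r hr _
    obtain rfl : r = 0 := by simpa using hr
    simp
  | succ n ih =>
    intro k r hr hN
    rw [Finset.sum_range_succ, mul_add]
    have hk : k * 2 ^ (n + 1) = (2 * k) * 2 ^ n := by ring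
    have hbn : 0 ≤ H * b ^ n := by positivity
    rw [hk] at hN ⊢
    rcases lt_or_ge r (2 ^ n) with h | h
    · exact (ih (2 * k) r h hN).trans (le_add_of_nonneg_right hbn)
    · obtain ⟨r', rfl⟩ := Nat.exists_eq_add_of_le h
      have e : 2 * k * 2 ^ n + (2 ^ n + r') = (2 * k + 1) * 2 ^ n + r' := by ring
      rw [e] at hN ⊢
      have h1 := ih (2 * k + 1) r' (by rw [pow_succ] at hr; omega) hN
      have h2 := hf n (2 * k) (by omega)
      exact (abs_sub_le _ (f ((2 * k + 1) * 2 ^ n)) _).trans (add_le_add h1 h2)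

/-- Round `i` and `j` down to multiples of `2 ^ n`. As `j - i < 2 ^ n`, the results are equal or
adjacent, which leaves two geometric tails and at most one increment of level `n`. -/
theorem abs_sub_le_of_dyadic {f : ℕ → ℝ} {N : ℕ} {H b : ℝ} (hH : 0 ≤ H) (hb : 1 < b)
    (hf : ∀ n k, (k + 1) * 2 ^ n ≤ N → |f ((k + 1) * 2 ^ n) - f (k * 2 ^ n)| ≤ H * b ^ n)
    {i j n : ℕ} (hij : i ≤ j) (hj : j ≤ N) (hn : j - i < 2 ^ n) :
    |f j - f i| ≤ (2 / (b - 1) + 1) * H * b ^ n := by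
  have hb0 : 0 < b - 1 := by linarith
  have hsum : ∑ l ∈ Finset.range n, b ^ l ≤ b ^ n / (b - 1) := by
    rw [geom_sum_eq hb.ne']
    gcongr
    linarith
  have hp : 0 < 2 ^ n := by positivity
  have hblock : ∀ m ≤ N, |f m - f (m / 2 ^ n * 2 ^ n)| ≤ H * (b ^ n / (b - 1)) := by
    intro m hm
    have e := Nat.div_add_mod' m (2 ^ n)
    have h1 := abs_sub_block_le hH (by linarith) hf n (m / 2 ^ n) (m % 2 ^ n)
      (Nat.mod_lt _ hp) (by rw [e]; exact hm)
    rw [e] at h1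
    exact h1.trans (by gcongr)
  have hbn : 0 ≤ H * b ^ n := by positivity
  have hmid : |f (j / 2 ^ n * 2 ^ n) - f (i / 2 ^ n * 2 ^ n)| ≤ H * b ^ n := by
    have h1 : i / 2 ^ n ≤ j / 2 ^ n := Nat.div_le_div_right hij
    have h2 : j / 2 ^ n ≤ i / 2 ^ n + 1 := by
      rw [← Nat.add_div_right i hp]
      exact Nat.div_le_div_right (by omega)
    rcases Nat.lt_or_ge (i / 2 ^ n) (j / 2 ^ n) with h | h
    · have h3 : j / 2 ^ n = i / 2 ^ n + 1 := by omega
      rw [h3]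
      refine hf n _ ?_
      rw [← h3]
      exact (Nat.div_mul_le_self j _).trans hj
    · rw [le_antisymm h h1]
      simpa using hbn
  have h1 := hblock j hj
  have h2 := hblock i (hij.trans hj)
  rw [abs_sub_comm] at h2
  calc |f j - f i| ≤ |f j - f (j / 2 ^ n * 2 ^ n)| + |f (j / 2 ^ n * 2 ^ n)
        - f (i / 2 ^ n * 2 ^ n)| + |f (i / 2 ^ n * 2 ^ n) - f i| := by
        refine (abs_sub_le _ (f (i / 2 ^ n * 2 ^ n)) _).trans ?_
        gcongr
        exact abs_sub_le _ _ _
    _ ≤ H * (b ^ n / (b - 1)) + H * b ^ n + H * (b ^ n / (b - 1)) := by gcongr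
    _ = (2 / (b - 1) + 1) * H * b ^ n := by ring

/-- The weighted sum of fourth powers of all dyadic increments of `f` up to index `N`. -/
noncomputable def chainSum (T N : ℕ) (f : ℕ → ℝ) : ℝ :=
  ∑ n ∈ Finset.range (Nat.log 2 N + 1), Real.sqrt T / Real.sqrt 2 ^ n *
    ∑ k ∈ Finset.range (N / 2 ^ n), (f ((k + 1) * 2 ^ n) - f (k * 2 ^ n)) ^ 4

/-- The constant in the chaining estimate. -/
noncomputable def chainConst : ℝ :=
  ((2 / ((2 : ℝ) ^ (1 / 8 : ℝ) - 1) + 1) * (2 : ℝ) ^ (1 / 8 : ℝ)) ^ 4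

theorem chainConst_nonneg : 0 ≤ chainConst := by
  unfold chainConst
  positivity

theorem chainSum_nonneg (T N : ℕ) (f : ℕ → ℝ) : 0 ≤ chainSum T N f :=
  Finset.sum_nonneg fun _ _ => mul_nonneg (by positivity)
    (Finset.sum_nonneg fun _ _ => by positivity)

/-- A single increment of level `n` is part of one summand of `chainSum`, so it is at most `H * b ^
n` with `b = 2^{1/8}`. Chaining uses the least power of two above `j - i`; this rounding is the
extra factor `b` in `chainConst`. -/
theorem pow_four_sub_le_chainSum {T N : ℕ} (hT : 0 < T) (f : ℕ → ℝ) {i j : ℕ} (hij : i ≤ j)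
    (hj : j ≤ N) :
    (f j - f i) ^ 4 ≤ chainConst * chainSum T N f * (((j : ℝ) - i) / T) ^ (1 / 2 : ℝ) := by
  have hT0 : (0 : ℝ) < T := by exact_mod_cast hT
  have hev : ∀ z : ℝ, |z| ^ 4 = z ^ 4 := Even.pow_abs (show Even 4 by decide)
  set Q := chainSum T N f with hQ
  have hQ0 : 0 ≤ Q := chainSum_nonneg T N f
  set b := (2 : ℝ) ^ (1 / 8 : ℝ) with hb
  have hb1 : 1 < b := Real.one_lt_rpow (by norm_num) (by norm_num)
  have hb4 : b ^ 4 = Real.sqrt 2 := by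
    rw [hb, rpow_pow_four (by norm_num), Real.sqrt_eq_rpow]
    norm_num
  set H := (Q / Real.sqrt T) ^ (1 / 4 : ℝ) with hH
  have hH0 : 0 ≤ H := by positivity
  have hH4 : H ^ 4 = Q / Real.sqrt T := by
    rw [hH, rpow_pow_four (by positivity)]
    norm_num
  have hf : ∀ n k, (k + 1) * 2 ^ n ≤ N → |f ((k + 1) * 2 ^ n) - f (k * 2 ^ n)| ≤ H * b ^ n := by
    intro n k hk
    refine le_of_pow_four_le (by positivity) ?_
    rw [hev, mul_pow, hH4, ← pow_mul, mul_comm n, pow_mul, hb4, div_mul_eq_mul_div,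
      le_div_iff₀ (by positivity)]
    have hn : n ∈ Finset.range (Nat.log 2 N + 1) := by
      refine Finset.mem_range.2 (Nat.lt_succ_of_le (Nat.le_log_of_pow_le (by norm_num) ?_))
      exact le_trans (Nat.le_mul_of_pos_left _ (by omega)) hk
    have hk' : k ∈ Finset.range (N / 2 ^ n) :=
      Finset.mem_range.2 ((Nat.le_div_iff_mul_le (by positivity)).2 hk)
    have h1 : (f ((k + 1) * 2 ^ n) - f (k * 2 ^ n)) ^ 4
        ≤ ∑ k ∈ Finset.range (N / 2 ^ n), (f ((k + 1) * 2 ^ n) - f (k * 2 ^ n)) ^ 4 :=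
      Finset.single_le_sum (f := fun k => (f ((k + 1) * 2 ^ n) - f (k * 2 ^ n)) ^ 4)
        (fun _ _ => by positivity) hk'
    have h2 : Real.sqrt T / Real.sqrt 2 ^ n * ∑ k ∈ Finset.range (N / 2 ^ n),
        (f ((k + 1) * 2 ^ n) - f (k * 2 ^ n)) ^ 4 ≤ Q :=
      Finset.single_le_sum (f := fun n => Real.sqrt T / Real.sqrt 2 ^ n *
        ∑ k ∈ Finset.range (N / 2 ^ n), (f ((k + 1) * 2 ^ n) - f (k * 2 ^ n)) ^ 4)
        (fun _ _ => mul_nonneg (by positivity) (Finset.sum_nonneg fun _ _ => by positivity)) hn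
    calc (f ((k + 1) * 2 ^ n) - f (k * 2 ^ n)) ^ 4 * Real.sqrt T
        = Real.sqrt T / Real.sqrt 2 ^ n * (f ((k + 1) * 2 ^ n) - f (k * 2 ^ n)) ^ 4
          * Real.sqrt 2 ^ n := by field_simp
      _ ≤ Q * Real.sqrt 2 ^ n := by
          gcongr
          exact le_trans (by gcongr) h2
  rcases hij.eq_or_lt with rfl | hlt
  · simp
  have hji : j - i ≠ 0 := by omega
  have hcast : ((j - i : ℕ) : ℝ) = (j : ℝ) - i := Nat.cast_sub hij
  have hji0 : (0 : ℝ) ≤ (j : ℝ) - i := by rw [← hcast]; positivity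
  have h1 := abs_sub_le_of_dyadic hH0 hb1 hf hij hj
    (Nat.lt_pow_succ_log_self (b := 2) (by norm_num) (j - i))
  have h2 : b ^ Nat.log 2 (j - i) ≤ ((j : ℝ) - i) ^ (1 / 8 : ℝ) := by
    have h3 : ((2 : ℝ) ^ Nat.log 2 (j - i)) ≤ (j : ℝ) - i := by
      rw [← hcast]
      exact_mod_cast Nat.pow_log_le_self 2 hji
    rw [hb, ← Real.rpow_natCast, ← Real.rpow_mul (by norm_num), mul_comm, Real.rpow_mul (by norm_num),
      Real.rpow_natCast]
    exact Real.rpow_le_rpow (by positivity) h3 (by norm_num)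
  have hcb : 0 ≤ 2 / (b - 1) + 1 := by
    have : 0 < b - 1 := by linarith
    positivity
  have h4 : |f j - f i| ≤ ((2 / (b - 1) + 1) * b) * H * ((j : ℝ) - i) ^ (1 / 8 : ℝ) := by
    refine h1.trans ?_
    rw [pow_succ]
    calc (2 / (b - 1) + 1) * H * (b ^ Nat.log 2 (j - i) * b)
        = ((2 / (b - 1) + 1) * b) * H * b ^ Nat.log 2 (j - i) := by ring
      _ ≤ _ := by gcongr
  calc (f j - f i) ^ 4 = |f j - f i| ^ 4 := (hev _).symm
    _ ≤ (((2 / (b - 1) + 1) * b) * H * ((j : ℝ) - i) ^ (1 / 8 : ℝ)) ^ 4 := by gcongr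
    _ = chainConst * Q * (((j : ℝ) - i) / T) ^ (1 / 2 : ℝ) := by
        rw [mul_pow, mul_pow, hH4, rpow_pow_four hji0, Real.div_rpow hji0 hT0.le,
          ← Real.sqrt_eq_rpow (T : ℝ), chainConst]
        norm_num only
        ring

/-- Level `n` has at most `κ T / 2^n` increments of fourth moment `c (2^n / T)²`, so with its weight
it contributes at most `c κ √2^n / √T`. The geometric sum is governed by the top level, where `2^n ≤
κ T` and `√T` cancels. -/
theorem integral_chainSum_le {Ω : Type*} [MeasurableSpace Ω] {P : Measure Ω} {T N : ℕ} (hT : 0 < T)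
    (hN0 : 0 < N) {κ c : ℝ} (hN : N ≤ κ * T) (hκ : 0 ≤ κ) (hc : 0 ≤ c) {X : ℕ → Ω → ℝ}
    (hX : ∀ s t, s ≤ t → t ≤ N → Integrable (fun ω => (X t ω - X s ω) ^ 4) P ∧
      ∫ ω, (X t ω - X s ω) ^ 4 ∂P ≤ c * (((t : ℝ) - s) / T) ^ 2) :
    Integrable (fun ω => chainSum T N fun t => X t ω) P ∧
    ∫ ω, chainSum T N (fun t => X t ω) ∂P
      ≤ c * κ * Real.sqrt κ * (Real.sqrt 2 / (Real.sqrt 2 - 1)) := by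
  have hT0 : (0 : ℝ) < T := by exact_mod_cast hT
  have hle : ∀ n k, k ∈ Finset.range (N / 2 ^ n) → (k + 1) * 2 ^ n ≤ N := fun n k hk =>
    (Nat.le_div_iff_mul_le (by positivity)).1 (Finset.mem_range.1 hk)
  have hX' : ∀ n k, k ∈ Finset.range (N / 2 ^ n) →
      Integrable (fun ω => (X ((k + 1) * 2 ^ n) ω - X (k * 2 ^ n) ω) ^ 4) P ∧
      ∫ ω, (X ((k + 1) * 2 ^ n) ω - X (k * 2 ^ n) ω) ^ 4 ∂P ≤ c * ((2 : ℝ) ^ n / T) ^ 2 := by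
    intro n k hk
    have h := hX (k * 2 ^ n) ((k + 1) * 2 ^ n) (by gcongr; omega) (hle n k hk)
    refine ⟨h.1, h.2.trans (le_of_eq ?_)⟩
    push_cast
    ring
  have hi : ∀ n, Integrable (fun ω => ∑ k ∈ Finset.range (N / 2 ^ n),
      (X ((k + 1) * 2 ^ n) ω - X (k * 2 ^ n) ω) ^ 4) P := fun n =>
    integrable_finsetSum _ fun k hk => (hX' n k hk).1
  unfold chainSum
  refine ⟨integrable_finsetSum _ fun n _ => (hi n).const_mul _, ?_⟩
  rw [integral_finsetSum _ fun n _ => (hi n).const_mul _]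
  have h2s : (1 : ℝ) < Real.sqrt 2 := Real.lt_sqrt_of_sq_lt (by norm_num)
  have hss : Real.sqrt 2 * Real.sqrt 2 = 2 := Real.mul_self_sqrt (by norm_num)
  have hterm : ∀ n ∈ Finset.range (Nat.log 2 N + 1),
      ∫ ω, Real.sqrt T / Real.sqrt 2 ^ n * ∑ k ∈ Finset.range (N / 2 ^ n),
        (X ((k + 1) * 2 ^ n) ω - X (k * 2 ^ n) ω) ^ 4 ∂P
      ≤ c * κ / Real.sqrt T * Real.sqrt 2 ^ n := by
    intro n _
    rw [integral_const_mul, integral_finsetSum _ fun k hk => (hX' n k hk).1]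
    have h1 : ∑ k ∈ Finset.range (N / 2 ^ n),
        ∫ ω, (X ((k + 1) * 2 ^ n) ω - X (k * 2 ^ n) ω) ^ 4 ∂P
        ≤ (κ * T / 2 ^ n) * (c * ((2 : ℝ) ^ n / T) ^ 2) := by
      refine (Finset.sum_le_sum fun k hk => (hX' n k hk).2).trans ?_
      rw [Finset.sum_const, Finset.card_range, nsmul_eq_mul]
      gcongr
      refine Nat.cast_div_le.trans ?_
      push_cast
      gcongr
    calc _ ≤ Real.sqrt T / Real.sqrt 2 ^ n * ((κ * T / 2 ^ n) * (c * ((2 : ℝ) ^ n / T) ^ 2)) := by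
          gcongr
      _ = c * κ * (Real.sqrt T / T) * (2 ^ n / Real.sqrt 2 ^ n) := by
          field_simp
      _ = c * κ / Real.sqrt T * Real.sqrt 2 ^ n := by
          have e1 : (2 : ℝ) ^ n / Real.sqrt 2 ^ n = Real.sqrt 2 ^ n := by
            rw [div_eq_iff (by positivity), ← mul_pow, hss]
          rw [e1, Real.sqrt_div_self]
          ring
  refine (Finset.sum_le_sum hterm).trans ?_
  rw [← Finset.mul_sum, geom_sum_eq h2s.ne']
  have hpow : Real.sqrt 2 ^ Nat.log 2 N ≤ Real.sqrt κ * Real.sqrt T := by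
    rw [← Real.sqrt_mul hκ]
    refine Real.le_sqrt_of_sq_le ?_
    rw [← pow_mul, mul_comm, pow_mul, Real.sq_sqrt (by norm_num)]
    exact le_trans (by exact_mod_cast Nat.pow_log_le_self 2 hN0.ne') hN
  have h2s0 : 0 < Real.sqrt 2 - 1 := by linarith
  calc c * κ / Real.sqrt T * ((Real.sqrt 2 ^ (Nat.log 2 N + 1) - 1) / (Real.sqrt 2 - 1))
      ≤ c * κ / Real.sqrt T * ((Real.sqrt κ * Real.sqrt T * Real.sqrt 2) / (Real.sqrt 2 - 1)) := by
        gcongr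
        rw [pow_succ]
        have : Real.sqrt 2 ^ Nat.log 2 N * Real.sqrt 2 ≤ Real.sqrt κ * Real.sqrt T * Real.sqrt 2 := by
          gcongr
        linarith
    _ = c * κ * Real.sqrt κ * (Real.sqrt 2 / (Real.sqrt 2 - 1)) := by
        field_simp

/-! ### Tightness -/

/-- The initial fourth power and the chaining sum of the `i`-th feature of a sequence of vectors. -/
noncomputable def featureStat {d : ℕ} (T N : ℕ) (v : ℕ → Fin d → ℝ) (i : ℕ) : ℝ :=
  feature d i (v 0) ^ 4 + chainSum T N fun t => feature d i (v t)

/-- The statistic of a sequence of vectors that controls its space-time interpolation. -/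
noncomputable def pathStat {d : ℕ} (T N : ℕ) (v : ℕ → Fin d → ℝ) : ℝ :=
  featureStat T N v 0 + (d : ℝ)⁻¹ * ∑ k ∈ Finset.range d, featureStat T N v (k + 1)

theorem featureStat_nonneg {d : ℕ} (T N : ℕ) (v : ℕ → Fin d → ℝ) (i : ℕ) :
    0 ≤ featureStat T N v i :=
  add_nonneg (by positivity) (chainSum_nonneg _ _ _)

theorem pathStat_nonneg {d : ℕ} (T N : ℕ) (v : ℕ → Fin d → ℝ) : 0 ≤ pathStat T N v :=
  add_nonneg (featureStat_nonneg _ _ _ _)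
    (mul_nonneg (by positivity) (Finset.sum_nonneg fun _ _ => featureStat_nonneg _ _ _ _))

/-- Energy and `pathStat` are the same average over features, so a featurewise bound passes through
unchanged and no maximum over `d` features is taken. -/
theorem energy_le_mul_pathStat {d : ℕ} {T N : ℕ} {v : ℕ → Fin d → ℝ} {w : Fin d → ℝ} {r : ℝ}
    (h : ∀ i, feature d i w ^ 4 ≤ r * featureStat T N v i) : energy w ≤ r * pathStat T N v := by
  rw [energy_eq_feature, pathStat, mul_add, mul_left_comm r]
  have h1 : ∑ k ∈ Finset.range d, feature d (k + 1) w ^ 4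
      ≤ ∑ k ∈ Finset.range d, r * featureStat T N v (k + 1) := Finset.sum_le_sum fun k _ => h _
  rw [← Finset.mul_sum] at h1
  have h2 := h 0
  gcongr

theorem energy_zero_le_pathStat {d : ℕ} (T N : ℕ) (v : ℕ → Fin d → ℝ) :
    energy (v 0) ≤ pathStat T N v := by
  rw [← one_mul (pathStat T N v)]
  refine energy_le_mul_pathStat fun i => ?_
  rw [one_mul]
  exact le_add_of_nonneg_right (chainSum_nonneg _ _ _)

theorem energy_sub_le_pathStat {d : ℕ} {T N : ℕ} (hT : 0 < T) (v : ℕ → Fin d → ℝ) {i j : ℕ}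
    (hij : i ≤ j) (hj : j ≤ N) :
    energy (v j - v i) ≤ chainConst * (((j : ℝ) - i) / T) ^ (1 / 2 : ℝ) * pathStat T N v := by
  refine energy_le_mul_pathStat fun k => ?_
  rw [map_sub]
  have hr : (0 : ℝ) ≤ (((j : ℝ) - i) / T) ^ (1 / 2 : ℝ) :=
    Real.rpow_nonneg (div_nonneg (sub_nonneg.2 (by exact_mod_cast hij)) (by positivity)) _
  have := chainConst_nonneg
  refine (pow_four_sub_le_chainSum hT (fun t => feature d k (v t)) hij hj).trans ?_
  rw [mul_right_comm]
  gcongr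
  exact le_add_of_nonneg_left (by positivity)

theorem spaceTimeInterp_mem_of_pathStat_le {d : ℕ} (hd : 0 < d) {τ κ Q : ℝ} {T N : ℕ}
    (hT : 0 < T) (hN : 0 < N) (hτN : T * τ ≤ N) (hNκ : N ≤ κ * T)
    {v : ℕ → Fin d → ℝ} (hQ : pathStat T N v ≤ Q) :
    spaceTimeInterp τ T v ∈ pathCompact τ
      (6 * (8 * (chainConst * (κ ^ (1 / 2 : ℝ) + 1) + 1) * Q) ^ (1 / 4 : ℝ)) := by
  have hT0 : (0 : ℝ) < T := by exact_mod_cast hT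
  have hQ0 := (pathStat_nonneg T N v).trans hQ
  have hκ : 0 ≤ κ := by
    by_contra h
    have h1 : κ * T < 0 := mul_neg_of_neg_of_pos (not_le.1 h) hT0
    have h2 : (0 : ℝ) ≤ N := Nat.cast_nonneg N
    linarith
  have hc := chainConst_nonneg
  have hκ' : 0 ≤ κ ^ (1 / 2 : ℝ) := Real.rpow_nonneg hκ _
  -- `G ^ 4` must dominate `8` times the initial energy plus the energy of the increment from time
  -- `0`, whose time factor is at most `κ ^ (1 / 2)`, and also `chainConst * Q` for general
  -- increments.
  set G := (8 * (chainConst * (κ ^ (1 / 2 : ℝ) + 1) + 1) * Q) ^ (1 / 4 : ℝ) with hG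
  have hG0 : 0 ≤ G := by positivity
  have hG4 : G ^ 4 = 8 * (chainConst * (κ ^ (1 / 2 : ℝ) + 1) + 1) * Q := by
    rw [hG, rpow_pow_four (by positivity)]
    norm_num
  have hcκ : 0 ≤ chainConst * κ ^ (1 / 2 : ℝ) * Q := by positivity
  have hcQ : 0 ≤ chainConst * Q := by positivity
  refine spaceTimeInterp_mem_pathCompact hd hT hN hτN hG0 (fun t ht => ?_) fun i j hij hj => ?_
  · have h1 := energy_le_of_sub (v t) (v 0)
    have h2 := energy_sub_le_pathStat hT v (Nat.zero_le t) ht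
    have h3 := energy_zero_le_pathStat T N v
    have h4 : (((t : ℝ) - (0 : ℕ)) / T) ^ (1 / 2 : ℝ) ≤ κ ^ (1 / 2 : ℝ) := by
      simp only [Nat.cast_zero, sub_zero]
      refine Real.rpow_le_rpow (by positivity) ?_ (by norm_num)
      rw [div_le_iff₀ hT0]
      exact le_trans (by exact_mod_cast ht) hNκ
    have h5 : energy (v t - v 0) ≤ chainConst * κ ^ (1 / 2 : ℝ) * Q := by
      refine h2.trans ?_
      have := pathStat_nonneg T N v
      gcongr
    rw [hG4]
    linarith
  · have hr : (0 : ℝ) ≤ (((j : ℝ) - i) / T) ^ (1 / 2 : ℝ) :=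
      Real.rpow_nonneg (div_nonneg (sub_nonneg.2 (by exact_mod_cast hij)) (by positivity)) _
    have h1 : chainConst * Q ≤ G ^ 4 := by
      rw [hG4]
      linarith
    calc energy (v j - v i)
        ≤ chainConst * (((j : ℝ) - i) / T) ^ (1 / 2 : ℝ) * Q :=
          (energy_sub_le_pathStat hT v hij hj).trans (by gcongr)
      _ = chainConst * Q * (((j : ℝ) - i) / T) ^ (1 / 2 : ℝ) := by ring
      _ ≤ _ := by gcongr

theorem integral_pathStat_le {Ω : Type*} [MeasurableSpace Ω] {P : Measure Ω} {d T N : ℕ}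
    (hd : 0 < d) (hT : 0 < T) (hN0 : 0 < N) {κ c : ℝ} (hN : N ≤ κ * T) (hκ : 0 ≤ κ) (hc : 0 ≤ c)
    {v : Ω → ℕ → Fin d → ℝ}
    (hv : ∀ i ≤ d, (Integrable (fun ω => feature d i (v ω 0) ^ 4) P ∧
        ∫ ω, feature d i (v ω 0) ^ 4 ∂P ≤ c) ∧
      ∀ s t, s ≤ t → t ≤ N →
        Integrable (fun ω => (feature d i (v ω t) - feature d i (v ω s)) ^ 4) P ∧
        ∫ ω, (feature d i (v ω t) - feature d i (v ω s)) ^ 4 ∂P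
          ≤ c * (((t : ℝ) - s) / T) ^ 2) :
    Integrable (fun ω => pathStat T N (v ω)) P ∧
    ∫ ω, pathStat T N (v ω) ∂P
      ≤ 2 * (c + c * κ * Real.sqrt κ * (Real.sqrt 2 / (Real.sqrt 2 - 1))) := by
  set c' := c + c * κ * Real.sqrt κ * (Real.sqrt 2 / (Real.sqrt 2 - 1)) with hc'
  have hd0 : (0 : ℝ) < d := by exact_mod_cast hd
  have hfeat : ∀ i ≤ d, Integrable (fun ω => featureStat T N (v ω) i) P ∧
      ∫ ω, featureStat T N (v ω) i ∂P ≤ c' := by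
    intro i hi
    obtain ⟨⟨h1, h2⟩, h3⟩ := hv i hi
    obtain ⟨h4, h5⟩ := integral_chainSum_le hT hN0 hN hκ hc
      (X := fun t ω => feature d i (v ω t)) h3
    refine ⟨h1.add h4, ?_⟩
    unfold featureStat
    rw [integral_add h1 h4]
    exact add_le_add h2 h5
  have hsum : Integrable (fun ω => ∑ k ∈ Finset.range d, featureStat T N (v ω) (k + 1)) P :=
    integrable_finsetSum _ fun k hk => (hfeat (k + 1) (Finset.mem_range.1 hk)).1
  refine ⟨(hfeat 0 hd.le).1.add (hsum.const_mul _), ?_⟩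
  unfold pathStat
  rw [integral_add (hfeat 0 hd.le).1 (hsum.const_mul _), integral_const_mul,
    integral_finsetSum _ fun k hk => (hfeat (k + 1) (Finset.mem_range.1 hk)).1, two_mul]
  refine add_le_add (hfeat 0 hd.le).2 ?_
  rw [inv_mul_le_iff₀ hd0]
  refine (Finset.sum_le_sum fun k hk => (hfeat (k + 1) (Finset.mem_range.1 hk)).2).trans ?_
  simp

theorem measure_le_of_integral_le {Ω : Type*} [MeasurableSpace Ω] {P : Measure Ω}
    [IsProbabilityMeasure P] {X : Ω → ℝ} (hX : Integrable X P) (h0 : ∀ ω, 0 ≤ X ω) {m Q : ℝ}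
    (hm : ∫ ω, X ω ∂P ≤ m) (hQ : 0 < Q) : P {ω | Q < X ω} ≤ ENNReal.ofReal (m / Q) := by
  have h1 := mul_meas_ge_le_integral_of_nonneg (ae_of_all P h0) hX Q
  have h2 : P.real {ω | Q ≤ X ω} ≤ m / Q := by
    rw [le_div_iff₀' hQ]
    exact h1.trans hm
  calc P {ω | Q < X ω} ≤ P {ω | Q ≤ X ω} := measure_mono fun ω (hω : Q < X ω) => hω.le
    _ = ENNReal.ofReal (P.real {ω | Q ≤ X ω}) := (ofReal_measureReal).symm
    _ ≤ _ := ENNReal.ofReal_le_ofReal h2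

end OnlineSGD

theorem mainTheorem4
    (τ : ℝ) (hτ : 0 < τ)
    -- moment functions of the data process
    (A : OnlineSGD.I → OnlineSGD.I → ℝ) (B : (Fin 4 → OnlineSGD.I) → ℝ)
    (E : (Fin 8 → OnlineSGD.I) → ℝ) (hABE : OnlineSGD.SmoothMoments A B E)
    -- constants independent of `d` and `T`
    (C₁ R L C : ℝ) (hC₁ : 0 < C₁) (hC : 0 < C)
    -- step sizes and noise levels
    (η σ : ℕ+ → ℕ+ → ℝ) (hη : ∀ d T, 0 < η d T) (hσ : ∀ d T, 0 ≤ σ d T)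
    (hbound : ∀ d T : ℕ+,
      max (η d T * (d : ℝ) * (T : ℝ)) (η d T * σ d T * Real.sqrt (T : ℝ)) ≤ C)
    -- for every dimension `d` and time resolution `T`: the probability space and the random data
    {Ω : ℕ+ → ℕ+ → Type*} [∀ d T, MeasurableSpace (Ω d T)]
    (P : ∀ d T, Measure (Ω d T)) [∀ d T, IsProbabilityMeasure (P d T)]
    (W : ∀ d T, ℝ≥0 → OnlineSGD.I → Ω d T → ℝ)
    (ε : ∀ d T, ℕ → Ω d T → ℝ)
    (θstar : ∀ d _T : ℕ+, Fin d → ℝ)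
    (θ₀ : ∀ d T : ℕ+, Ω d T → Fin d → ℝ)
    (hW : ∀ d T, OnlineSGD.IsDataProcess (P d T) (W d T) A B E)
    (hε : ∀ d T, OnlineSGD.IsNoise (P d T) (ε d T) (σ d T) C₁)
    (hinit : ∀ d T,
      OnlineSGD.IsInitialCondition (P d T) (fun ω => θ₀ d T ω - θstar d T) R L)
    -- the data process is independent of the initial guess and the noise
    (hindep : ∀ d T : ℕ+,
      IndepFun (fun (ω : Ω d T) (p : ℝ≥0 × OnlineSGD.I) => W d T p.1 p.2 ω)
        (fun (ω : Ω d T) => (θ₀ d T ω, fun t : ℕ => ε d T t ω)) (P d T))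
    -- the interpolated SGD processes
    (Θ : ∀ d T, Ω d T → OnlineSGD.PathSpace τ)
    (hΘ : ∀ d T : ℕ+, Θ d T =
      OnlineSGD.interpolatedSGD τ d T (η d T) (W d T) (ε d T) (θstar d T) (θ₀ d T)) :
    (∀ d T, Measurable (Θ d T)) ∧
    IsTightMeasureSet (Set.range fun p : ℕ+ × ℕ+ => (P p.1 p.2).map (Θ p.1 p.2)) ∧
    ∀ p : ℕ → ℕ+ × ℕ+, ∃ φ : ℕ → ℕ, StrictMono φ ∧
      ∃ (μ : Measure (OnlineSGD.PathSpace τ)) (_ : IsProbabilityMeasure μ),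
        TendstoInDistribution (fun k => Θ (p (φ k)).1 (p (φ k)).2) atTop id
          (fun k => P (p (φ k)).1 (p (φ k)).2) μ := by
  -- The horizon is `κ = τ + 2`: the index `⌈T τ⌉ + 1` is positive, covers `[0,τ]` and is at most `T
  -- τ + 2 ≤ (τ + 2) T`.
  obtain ⟨c, hc0, hc⟩ :=
    OnlineSGD.exists_moment_estimates hABE (τ + 2) C₁ R L C (by linarith) hC₁.le
  have hθ₀ : ∀ d T, Measurable (θ₀ d T) := fun d T => by
    simpa using (hinit d T).measurable.add_const (θstar d T)
  have hmeas : ∀ d T, Measurable (Θ d T) := fun d T => by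
    rw [hΘ]
    exact OnlineSGD.measurable_interpolatedSGD τ d T _ (hW d T).measurable (hε d T).measurable
      (hθ₀ d T)
  set m := 2 * (c + c * (τ + 2) * Real.sqrt (τ + 2) * (Real.sqrt 2 / (Real.sqrt 2 - 1))) with hm
  have htight : IsTightMeasureSet
      (Set.range fun p : ℕ+ × ℕ+ => (P p.1 p.2).map (Θ p.1 p.2)) := by
    rw [isTightMeasureSet_iff_exists_isCompact_measure_compl_le]
    intro e he
    have hlim : Tendsto (fun Q : ℝ => ENNReal.ofReal (m / Q)) atTop (𝓝 0) := by
      rw [← ENNReal.ofReal_zero]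
      exact ENNReal.tendsto_ofReal (tendsto_const_nhds.div_atTop tendsto_id)
    obtain ⟨Q, hQe, hQ⟩ := ((hlim.eventually (gt_mem_nhds he)).and (eventually_gt_atTop 0)).exists
    -- The compact set depends on `τ` and `Q` only, so it serves every law of the family.
    refine ⟨_, OnlineSGD.isCompact_pathCompact τ (6 * (8 * (OnlineSGD.chainConst
      * ((τ + 2) ^ (1 / 2 : ℝ) + 1) + 1) * Q) ^ (1 / 4 : ℝ)), ?_⟩
    rintro _ ⟨⟨d, T⟩, rfl⟩
    have hT0 : (0 : ℝ) < (T : ℕ) := by exact_mod_cast T.pos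
    have hT1 : (1 : ℝ) ≤ (T : ℕ) := by exact_mod_cast T.pos
    have hN1 : (T : ℕ) * τ ≤ ((⌈(T : ℕ) * τ⌉₊ + 1 : ℕ) : ℝ) := by
      push_cast
      linarith [Nat.le_ceil ((T : ℕ) * τ)]
    have hN2 : ((⌈(T : ℕ) * τ⌉₊ + 1 : ℕ) : ℝ) ≤ (τ + 2) * (T : ℕ) := by
      push_cast
      have := Nat.ceil_lt_add_one (show 0 ≤ (T : ℕ) * τ by positivity)
      linarith
    have hb := hbound d T
    have hstat := OnlineSGD.integral_pathStat_le d.pos T.pos (Nat.succ_pos _) hN2 (by linarith) hc0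
      (hc d T d.pos T.pos (η d T) (σ d T) (hη d T) (hσ d T) ((le_max_left _ _).trans hb)
        ((le_max_right _ _).trans hb) (P d T) (W d T) (ε d T) (θstar d T) (θ₀ d T) (hW d T)
        (hε d T) (hinit d T) (hindep d T) _ hN2)
    rw [Measure.map_apply (hmeas d T) (OnlineSGD.isCompact_pathCompact τ _).measurableSet.compl]
    refine le_trans (measure_mono ?_) ((OnlineSGD.measure_le_of_integral_le hstat.1
      (fun ω => OnlineSGD.pathStat_nonneg _ _ _) hstat.2 hQ).trans hQe.le)
    intro ω hω
    by_contra hle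
    refine hω ?_
    rw [hΘ]
    exact OnlineSGD.spaceTimeInterp_mem_of_pathStat_le d.pos T.pos (Nat.succ_pos _) hN1 hN2
      (not_lt.1 hle)
  refine ⟨hmeas, htight, fun p => ?_⟩
  refine OnlineSGD.exists_subseq_tendstoInDistribution (fun k => P (p k).1 (p k).2)
    (fun k => Θ (p k).1 (p k).2) (fun k => hmeas _ _) (htight.subset ?_)
  rintro _ ⟨k, rfl⟩
  exact ⟨p k, rfl⟩
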